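/- Let $F$ be an algebraically closed field of characteristic $\neq 2$. For $i=1,\dots,n$ let $L_i(X)=a_i(t)+b_i(t)X$ with $a_i,b_i\in F[t]$, $b_i\neq 0$, be linear functions over $F[t]$ that are primitive, i.e. $\gcd(a_i,b_i)=1$, and distinct up to constant multiples, i.e. for $i\neq j$ there is no $c\in F^\times$ with $L_j=cL_i$. Let $f_0\in F[t]$ be monic of degree $k$, let $2\le m<k$, and assume that $\deg L_i(f_0)\ge \deg b_i+m$ for every $i$. Let $\mathbf A=(A_0,\dots,A_m)$ be independent variables over $F$ and let $f=f_0+\sum_{j=0}^m A_jt^j\in F(\mathbf A)[t]$. Then $$\mathrm{Gal}\Big(\prod_{i=1}^n L_i(f),F(\mathbf A)\Big)=\prod_{i=1}^n\mathrm{Gal}\big(L_i(f),F(\mathbf A)\big)=S_{k_1}\times\cdots\times S_{k_n},\qquad k_i=\deg L_i(f_0).$$ Here $L_i(f)=a_i+b_if$, and $\mathrm{Gal}(p,K)$ is the automorphism group over $K$ of the splitting field of $p\in K[t]$. The first equality means that restriction to the splitting fields of the factors is an isomorphism; the second means that each $L_i(f)$ has exactly $k_i$ distinct roots and that $\mathrm{Gal}(L_i(f),F(\mathbf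 A))$ acts on them as the full symmetric group. -/

import Mathlib

open Polynomial

/-- A linear function `L(X) = a(t) + b(t) X` over `F[t]`, with `b ≠ 0`. -/
@[ext]
structure LinearFunction (F : Type*) [Field F] where
  /-- the constant coefficient `a(t)` -/
  a : F[X]
  /-- the coefficient `b(t)` of `X` -/
  b : F[X]
  b_ne_zero : b ≠ 0

namespace LinearFunction

variable {F : Type*} [Field F]

/-- `L = a + b X` is primitive if `gcd(a, b) = 1`. -/
def IsPrimitive (L : LinearFunction F) : Prop := IsCoprime L.a L.b

/-- `L'` is a nonzero constant multiple of `L`, so that the two agree up to a unit of `F[t]`. -/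
def IsAssociated (L L' : LinearFunction F) : Prop :=
  ∃ c : F, c ≠ 0 ∧ L'.a = C c * L.a ∧ L'.b = C c * L.b

/-- The value `L(f) = a + b f` at a polynomial `f ∈ K[t]`, for a field extension `K` of `F`. -/
noncomputable def eval {K : Type*} [Field K] [Algebra F K] (L : LinearFunction F) (f : K[X]) :
    K[X] :=
  L.a.map (algebraMap F K) + L.b.map (algebraMap F K) * f

end LinearFunction

/-- The field `F(A) = F(A_0, …, A_m)` of rational functions in `m + 1` variables. -/
abbrev ParamField (F : Type*) [Field F] (m : ℕ) : Type _ :=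
  FractionRing (MvPolynomial (Fin (m + 1)) F)

/-- The variable `A_j`, as an element of `F(A)`. -/
noncomputable def paramVar (F : Type*) [Field F] (m : ℕ) (j : Fin (m + 1)) : ParamField F m :=
  algebraMap (MvPolynomial (Fin (m + 1)) F) (ParamField F m) (MvPolynomial.X j)

/-- The generic perturbation `f = f₀ + ∑_{j=0}^m A_j t^j`, a polynomial in `t` over `F(A)`. -/
noncomputable def genericPerturbation {F : Type*} [Field F] (m : ℕ) (f₀ : F[X]) :
    (ParamField F m)[X] :=
  f₀.map (algebraMap F (ParamField F m)) +
    ∑ j : Fin (m + 1), C (paramVar F m j) * X ^ (j : ℕ)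

/-- For `p = ∏ i, p i`, the natural homomorphism `Gal(p) → ∏ i, Gal(p i)` which restricts an
automorphism of the splitting field of the product to the splitting field of each factor. -/
noncomputable def galProdRestrict {K : Type*} [Field K] {n : ℕ} (p : Fin n → K[X]) :
    (∏ i, p i).Gal →* ∀ i, (p i).Gal :=
  MonoidHom.pi fun i =>
    Polynomial.Gal.restrictDvd (Finset.dvd_prod_of_mem p (Finset.mem_univ i))

/-- The action of `Gal(p)` on the set of roots of `p` in its splitting field, as a homomorphism to
the symmetric group on that set. -/
noncomputable def galRootPerm {K : Type*} [Field K] (p : K[X]) :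
    p.Gal →* Equiv.Perm (p.rootSet p.SplittingField) :=
  @MulAction.toPermHom p.Gal (p.rootSet p.SplittingField) _ (Polynomial.Gal.galActionAux p)

/-! Each group Gal(L_i(f)) is doubly transitive on the roots. If x ≠ y are roots, then f = -a_i/b_i
at both, which gives two linear equations for A_0 and A_1; so F(A) lies in F(x, y, A_2, …, A_m). By
transcendence degree these m + 1 generators are algebraically independent, and replacing x, y by
another pair of roots extends to an automorphism over F(A) (`exists_algEquiv_map_pair`). A multiple
root x would put F(A) inside F(x, A_2, …, A_m), whose transcendence degree is too small, so L_i(f)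
is separable.

For every i, the Galois group of the product contains an element that swaps two roots of L_i(f) and
fixes all other roots: the inertia at a simple branch point. One specializes A so that L_i(f) gets
exactly one double root and the other L_j(f) stay separable (`exists_specialization`, the only place
where characteristic ≠ 2 enters). Along a generic line through this point, with parameter s, simple
roots are power series in s by Hensel's lemma, whereas the double root ramifies because L_i(f)
vanishes there only to first order (`exists_ringEquiv_of_double_root_constantCoeff`).

The group of the product surjects onto each factor, so by double transitivity the conjugates of this
element give all transpositions in the i-th factor, with trivial components elsewhere. They generate
the full product (`MonoidHom.surjective_pi_of_isSwap`). -/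

/-! ### Permutation groups containing a transposition. -/

/-- A nontrivial permutation of a finite set that fixes all but at most two points is a
transposition. -/
theorem Equiv.Perm.isSwap_of_card_le_card_fixed_add_two {α : Type*} [Fintype α] [DecidableEq α]
    {σ : Equiv.Perm α} (hσ : σ ≠ 1) (S : Finset α) (hS : ∀ x ∈ S, σ x = x)
    (hcard : Fintype.card α ≤ S.card + 2) : σ.IsSwap := by
  rw [← Equiv.Perm.card_support_eq_two]
  refine le_antisymm ?_ (Equiv.Perm.two_le_card_support_of_ne_one hσ)
  have hdisj : _root_.Disjoint σ.support S := by
    rw [Finset.disjoint_left]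
    intro x hx hxS
    exact Equiv.Perm.mem_support.mp hx (hS x hxS)
  have := Finset.card_le_univ (σ.support ∪ S)
  rw [Finset.card_union_of_disjoint hdisj] at this
  omega

/-- A normal subgroup containing a transposition is everything, if the group acts faithfully and
doubly transitively. -/
theorem Subgroup.eq_top_of_isSwap_mem_of_doubly_transitive {H α : Type*} [Group H] [Finite α]
    [DecidableEq α] {ρ : H →* Equiv.Perm α} (hρ : Function.Injective ρ)
    (h2 : ∀ x y x' y' : α, x ≠ y → x' ≠ y' → ∃ h, ρ h x = x' ∧ ρ h y = y')
    (N : Subgroup H) [N.Normal] {τ : H} (hτ : τ ∈ N) (hswap : (ρ τ).IsSwap) :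
    N = ⊤ ∧ Function.Surjective ρ := by
  have hmap : N.map ρ = ⊤ := by
    rw [eq_top_iff, ← Equiv.Perm.closure_isSwap, Subgroup.closure_le]
    rintro _ ⟨x', y', hne', rfl⟩
    obtain ⟨x, y, hne, hxy⟩ := hswap
    obtain ⟨h, rfl, rfl⟩ := h2 x y x' y' hne hne'
    refine ⟨h * τ * h⁻¹, Subgroup.Normal.conj_mem ‹_› τ hτ h, ?_⟩
    rw [map_mul, map_mul, hxy, map_inv, Equiv.swap_apply_apply]
  have hsurj : Function.Surjective ρ := fun g => by
    obtain ⟨h, -, rfl⟩ : g ∈ N.map ρ := by rw [hmap]; trivial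
    exact ⟨h, rfl⟩
  refine ⟨?_, hsurj⟩
  rw [eq_top_iff]
  intro h _
  obtain ⟨h', hh', e⟩ : ρ h ∈ N.map ρ := by rw [hmap]; trivial
  rwa [← hρ e]

/-- A subdirect product of doubly transitive permutation groups which contains, in every factor, an
element that acts as a transposition in that factor and trivially in all the others, is the full
product of symmetric groups. -/
theorem MonoidHom.surjective_pi_of_isSwap {ι : Type*} [Finite ι] [DecidableEq ι] {G : Type*}
    [Group G] {H : ι → Type*} [∀ i, Group (H i)] {α : ι → Type*} [∀ i, Finite (α i)]
    [∀ i, DecidableEq (α i)] (ρ : ∀ i, H i →* Equiv.Perm (α i))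
    (hρ : ∀ i, Function.Injective (ρ i))
    (h2 : ∀ i, ∀ x y x' y' : α i, x ≠ y → x' ≠ y' → ∃ h, ρ i h x = x' ∧ ρ i h y = y')
    (φ : G →* ∀ i, H i) (hφ : ∀ i (h : H i), ∃ g, φ g i = h)
    (hswap : ∀ i, ∃ g τ, φ g = Pi.mulSingle i τ ∧ (ρ i τ).IsSwap) :
    Function.Surjective φ ∧ ∀ i, Function.Surjective (ρ i) := by
  have key : ∀ i, φ.range.comap (MonoidHom.mulSingle H i) = ⊤ ∧ Function.Surjective (ρ i) := by
    intro i
    obtain ⟨g, τ, hg, hτ⟩ := hswap i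
    -- Any `h` is the `i`-th coordinate of some element of the range. Its other coordinates are
    -- harmless, since conjugation acts on the trivial element there.
    have hN : (φ.range.comap (MonoidHom.mulSingle H i)).Normal := by
      refine ⟨?_⟩
      rintro a ⟨g₁, hg₁⟩ h
      obtain ⟨g₂, rfl⟩ := hφ i h
      refine ⟨g₂ * g₁ * g₂⁻¹, ?_⟩
      rw [map_mul, map_mul, hg₁, map_inv]
      funext j
      by_cases hj : j = i
      · subst hj; simp
      · simp [Pi.mulSingle_eq_of_ne hj]
    exact Subgroup.eq_top_of_isSwap_mem_of_doubly_transitive (hρ i) (h2 i) _ (τ := τ) ⟨g, hg⟩ hτ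
  refine ⟨fun x => ?_, fun i => (key i).2⟩
  refine Subgroup.pi_mem_of_mulSingle_mem (H := φ.range) x fun i => ?_
  have : x i ∈ φ.range.comap (MonoidHom.mulSingle H i) := by rw [(key i).1]; trivial
  exact this

/-! ### Galois groups of products and their action on roots. -/

namespace Polynomial.Gal

variable {K : Type*} [Field K]

/-- Packages the embedding behind `restrictDvd`, so that equivariance can be used without the local
`Fact` instance. -/
theorem exists_restrictDvd_commutes {p q : K[X]} (h : p ∣ q) (hq : q ≠ 0) :
    ∃ κ : p.SplittingField →ₐ[K] q.SplittingField,
      ∀ (τ : q.Gal) (y : p.SplittingField), κ (restrictDvd h τ y) = τ (κ y) := by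
  classical
  have := Fact.mk <| (SplittingField.splits q).of_dvd (map_ne_zero hq) ((map_dvd_map' _).mpr h)
  refine ⟨IsScalarTower.toAlgHom K p.SplittingField q.SplittingField, fun τ y => ?_⟩
  rw [restrictDvd_def, dif_neg hq]
  exact AlgEquiv.restrictNormal_commutes τ p.SplittingField y

theorem exists_restrict_commutes {q : K[X]} {E : Type*} [Field E] [Algebra K E]
    (hs : (q.map (algebraMap K E)).Splits) (σ : Gal(E/K)) :
    ∃ (κ : q.SplittingField →ₐ[K] E) (τ : q.Gal), ∀ y, κ (τ y) = σ (κ y) := by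
  have := Fact.mk hs
  exact ⟨IsScalarTower.toAlgHom K q.SplittingField E, restrict q E σ,
    fun y => AlgEquiv.restrictNormal_commutes σ q.SplittingField y⟩

end Polynomial.Gal

theorem galRootPerm_injective {K : Type*} [Field K] (p : K[X]) :
    Function.Injective (galRootPerm p) := by
  intro σ τ h
  refine Polynomial.Gal.ext p fun x hx => ?_
  have := congrArg (fun g => ((g ⟨x, hx⟩ : p.rootSet p.SplittingField) : p.SplittingField)) h
  exact this

/-- As `p` already splits in its splitting field, a larger field contains no new roots. This moves
statements about roots between the two fields. -/
theorem Polynomial.SplittingField.exists_root_map_eq {K : Type*} [Field K] {p : K[X]} (hp : p ≠ 0)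
    {E : Type*} [Field E] [Algebra K E] (κ : p.SplittingField →ₐ[K] E) {x : E}
    (hx : aeval x p = 0) : ∃ y ∈ p.rootSet p.SplittingField, κ y = x := by
  have hs := SplittingField.splits p
  have hx' : x ∈ (κ : p.SplittingField →+* E).range := by
    refine hs.mem_range_of_isRoot (map_ne_zero hp) ?_
    rwa [map_map, AlgHom.comp_algebraMap, IsRoot.def, eval_map_algebraMap]
  obtain ⟨y, rfl⟩ := hx'
  refine ⟨y, mem_rootSet.mpr ⟨hp, κ.injective ?_⟩, rfl⟩
  rw [map_zero, ← hx]
  exact (aeval_algHom_apply κ y p).symm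

theorem galProdRestrict_injective {K : Type*} [Field K] {n : ℕ} (p : Fin n → K[X])
    (hp : ∀ i, p i ≠ 0) : Function.Injective (galProdRestrict p) := by
  have hP : ∏ i, p i ≠ 0 := Finset.prod_ne_zero_iff.mpr fun i _ => hp i
  intro σ τ h
  refine Polynomial.Gal.ext _ fun x hx => ?_
  rw [mem_rootSet, map_prod, Finset.prod_eq_zero_iff] at hx
  obtain ⟨-, i, -, hi⟩ := hx
  obtain ⟨κ, hκ⟩ := Polynomial.Gal.exists_restrictDvd_commutes
    (Finset.dvd_prod_of_mem p (Finset.mem_univ i)) hP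
  obtain ⟨y, -, rfl⟩ := SplittingField.exists_root_map_eq (hp i) κ hi
  have h1 : galProdRestrict p σ i = galProdRestrict p τ i := by rw [h]
  rw [← hκ, ← hκ]
  exact congrArg (fun g : (p i).Gal => κ (g y)) h1

/-- An automorphism of an extension in which all `p j` split, which fixes the roots of `p j` for
`j ≠ i` and all but at most two of the roots of `p i`, restricts to a transposition in the `i`-th
factor of `∏ j, Gal(p j)`. -/
theorem exists_galProdRestrict_eq_mulSingle_isSwap {K : Type*} [Field K] {n : ℕ}
    (p : Fin n → K[X]) (hp : ∀ i, p i ≠ 0) {E : Type*} [Field E] [Algebra K E]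
    (hs : ∀ i, ((p i).map (algebraMap K E)).Splits) (σ : Gal(E/K)) (i : Fin n)
    (hfix : ∀ j, j ≠ i → ∀ x : E, aeval x (p j) = 0 → σ x = x)
    (hmove : ∃ x : E, aeval x (p i) = 0 ∧ σ x ≠ x)
    (S : Finset E) (hS : ∀ x ∈ S, aeval x (p i) = 0 ∧ σ x = x)
    (hcard : (p i).natDegree ≤ S.card + 2)
    [DecidableEq ((p i).rootSet (p i).SplittingField)] :
    ∃ g τ, galProdRestrict p g = Pi.mulSingle i τ ∧ (galRootPerm (p i) τ).IsSwap := by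
  classical
  have hP : ∏ i, p i ≠ 0 := Finset.prod_ne_zero_iff.mpr fun i _ => hp i
  obtain ⟨κ, g, hg⟩ := Polynomial.Gal.exists_restrict_commutes (q := ∏ i, p i) (E := E)
    (by rw [Polynomial.map_prod]; exact Splits.prod fun j _ => hs j) σ
  -- Embeddings that turn the `j`-th restriction of `g` into `σ`; what `σ` does to roots in `E` can
  -- then be read off in each factor.
  have hj : ∀ j, ∃ κj : (p j).SplittingField →ₐ[K] E,
      ∀ y, κj (galProdRestrict p g j y) = σ (κj y) := fun j => by
    obtain ⟨κ', hκ'⟩ := Polynomial.Gal.exists_restrictDvd_commutes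
      (Finset.dvd_prod_of_mem p (Finset.mem_univ j)) hP
    exact ⟨κ.comp κ', fun y => (congrArg κ (hκ' g y)).trans (hg _)⟩
  have hroot : ∀ {j} (κj : (p j).SplittingField →ₐ[K] E) {y},
      y ∈ (p j).rootSet (p j).SplittingField → aeval (κj y) (p j) = 0 := fun κj y hy => by
    rw [aeval_algHom_apply, (mem_rootSet.mp hy).2, map_zero]
  refine ⟨g, galProdRestrict p g i, ?_, ?_⟩
  · funext j
    by_cases hji : j = i
    · subst hji; simp
    · rw [Pi.mulSingle_eq_of_ne hji]
      obtain ⟨κj, hκj⟩ := hj j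
      refine Polynomial.Gal.ext _ fun y hy => κj.injective ?_
      refine (hκj y).trans ?_
      exact hfix j hji _ (hroot κj hy)
  · obtain ⟨κi, hκi⟩ := hj i
    have hlift : ∀ x : E, aeval x (p i) = 0 →
        ∃ y : (p i).rootSet (p i).SplittingField, κi y = x := fun x hx => by
      obtain ⟨y, hy, e⟩ := SplittingField.exists_root_map_eq (hp i) κi hx
      exact ⟨⟨y, hy⟩, e⟩
    have : Fintype ((p i).rootSet (p i).SplittingField) := Fintype.ofFinite _
    have : Nonempty ((p i).rootSet (p i).SplittingField) :=
      let ⟨x, hx, _⟩ := hmove; let ⟨y, _⟩ := hlift x hx; ⟨y⟩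
    choose! l hl using hlift
    refine Equiv.Perm.isSwap_of_card_le_card_fixed_add_two ?_ (S.image l) ?_ ?_
    · obtain ⟨x, hx, hne⟩ := hmove
      intro h1
      apply hne
      have h2 : galProdRestrict p g i (l x) = l x :=
        congrArg Subtype.val (Equiv.Perm.ext_iff.mp h1 (l x))
      rw [← hl x hx, ← hκi, h2]
    · intro y hy
      obtain ⟨x, hx, rfl⟩ := Finset.mem_image.mp hy
      refine Subtype.ext (κi.injective ?_)
      refine (hκi _).trans ?_
      refine Eq.trans ?_ (hl x (hS x hx).1).symm
      rw [hl x (hS x hx).1, (hS x hx).2]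
    · rw [Finset.card_image_of_injOn]
      · rw [← Nat.card_eq_fintype_card]
        exact (ncard_rootSet_le _ _).trans hcard
      · intro x hx x' hx' e
        rw [← hl x (hS x hx).1, ← hl x' (hS x' hx').1, e]

/-! ### The field F(A) and its generating families. -/

theorem isTranscendenceBasis_paramVar (F : Type*) [Field F] (m : ℕ) :
    IsTranscendenceBasis F (paramVar F m) :=
  have : Algebra.IsAlgebraic (MvPolynomial (Fin (m + 1)) F) (ParamField F m) :=
    IsLocalization.isAlgebraic _ (nonZeroDivisors (MvPolynomial (Fin (m + 1)) F))
  (IsTranscendenceBasis.mvPolynomial (Fin (m + 1)) F).algebraMap_comp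

theorem ParamField.ringHom_ext {F : Type*} [Field F] {m : ℕ} {S : Type*} [CommRing S]
    {φ ψ : ParamField F m →+* S}
    (hF : ∀ c, φ (algebraMap F _ c) = ψ (algebraMap F _ c))
    (hA : ∀ j, φ (paramVar F m j) = ψ (paramVar F m j)) : φ = ψ := by
  refine IsLocalization.ringHom_ext (nonZeroDivisors (MvPolynomial (Fin (m + 1)) F)) ?_
  refine MvPolynomial.ringHom_ext (fun c => ?_) hA
  exact hF c

section Generic

variable {F : Type*} [Field F]

open scoped IntermediateField.algebraAdjoinAdjoin in
/-- If the variables `A_j` are rational functions of `m + 1` elements of an algebraic extension of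
`F(A)`, then these elements are algebraically independent. -/
theorem algebraicIndependent_of_paramVar_mem_adjoin {m : ℕ} {Ω : Type*} [Field Ω] [Algebra F Ω]
    [Algebra (ParamField F m) Ω] [IsScalarTower F (ParamField F m) Ω]
    [Algebra.IsAlgebraic (ParamField F m) Ω] (z : Fin (m + 1) → Ω)
    (hz : ∀ j, algebraMap _ Ω (paramVar F m j) ∈ IntermediateField.adjoin F (Set.range z)) :
    AlgebraicIndependent F z := by
  have hb : IsTranscendenceBasis F (algebraMap (ParamField F m) Ω ∘ paramVar F m) :=
    (isTranscendenceBasis_paramVar F m).algebraMap_comp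
  have htr := hb.lift_cardinalMk_eq_trdeg
  -- Since F(z) contains F(A), `Ω` is algebraic over F(z); the `m + 1` elements `z` must then be a
  -- transcendence basis, as the degree is `m + 1`.
  have halg : Algebra.IsAlgebraic (IntermediateField.adjoin F (Set.range z)) Ω := by
    have h1 := hb.isAlgebraic_field
    have hle : IntermediateField.adjoin F (Set.range (algebraMap (ParamField F m) Ω ∘ paramVar F m))
        ≤ IntermediateField.adjoin F (Set.range z) := by
      rw [IntermediateField.adjoin_le_iff]
      rintro _ ⟨j, rfl⟩
      exact hz j
    let _ := (IntermediateField.inclusion hle).toRingHom.toAlgebra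
    have : IsScalarTower
        (IntermediateField.adjoin F (Set.range (algebraMap (ParamField F m) Ω ∘ paramVar F m)))
        (IntermediateField.adjoin F (Set.range z)) Ω := IsScalarTower.of_algebraMap_eq fun _ => rfl
    exact Algebra.IsAlgebraic.tower_top (K := IntermediateField.adjoin F
      (Set.range (algebraMap (ParamField F m) Ω ∘ paramVar F m))) _
  have halg' : Algebra.IsAlgebraic (Algebra.adjoin F (Set.range z)) Ω :=
    Algebra.IsAlgebraic.trans _ (IntermediateField.adjoin F (Set.range z)) _
  exact (Algebra.IsAlgebraic.isTranscendenceBasis_of_lift_le_trdeg_of_finite F z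
    (by rw [← htr])).1

/-- If two families of elements of a normal extension of `F(A)` express the variables `A_j` by the
same rational functions, then they are conjugate over `F(A)`. -/
theorem exists_algEquiv_map_eq_of_paramVar_eq {m : ℕ} {Ω : Type*} [Field Ω] [Algebra F Ω]
    [Algebra (ParamField F m) Ω] [IsScalarTower F (ParamField F m) Ω]
    [Normal (ParamField F m) Ω] (z z' : Fin (m + 1) → Ω)
    (hz : ∀ j, ∃ e : IntermediateField.adjoin F (Set.range z),
      (e : Ω) = algebraMap _ Ω (paramVar F m j) ∧
      ∀ ψ : IntermediateField.adjoin F (Set.range z) →ₐ[F] Ω,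
        (∀ i, ψ ⟨z i, IntermediateField.subset_adjoin F _ ⟨i, rfl⟩⟩ = z' i) →
          ψ e = algebraMap _ Ω (paramVar F m j))
    (hz' : ∀ j, algebraMap _ Ω (paramVar F m j) ∈ IntermediateField.adjoin F (Set.range z')) :
    ∃ σ : Gal(Ω/ParamField F m), ∀ i, σ (z i) = z' i := by
  have hind : AlgebraicIndependent F z := algebraicIndependent_of_paramVar_mem_adjoin z fun j => by
    obtain ⟨e, he, -⟩ := hz j
    rw [← he]; exact e.2
  have hind' : AlgebraicIndependent F z' := algebraicIndependent_of_paramVar_mem_adjoin z' hz'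
  let N := IntermediateField.adjoin F (Set.range z)
  let ψ : N →ₐ[F] Ω := (IntermediateField.val _).comp
    (hind.aevalEquivField.symm.trans hind'.aevalEquivField).toAlgHom
  have hψ : ∀ i, ψ ⟨z i, IntermediateField.subset_adjoin F _ ⟨i, rfl⟩⟩ = z' i := fun i => by
    have h1 : hind.aevalEquivField (algebraMap (MvPolynomial (Fin (m + 1)) F) _ (MvPolynomial.X i)) =
        (⟨z i, IntermediateField.subset_adjoin F _ ⟨i, rfl⟩⟩ : N) := by
      ext
      rw [AlgebraicIndependent.aevalEquivField_algebraMap_apply_coe, MvPolynomial.aeval_X]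
    change ((hind'.aevalEquivField (hind.aevalEquivField.symm _) : _) : Ω) = _
    rw [← h1, AlgEquiv.symm_apply_apply,
      AlgebraicIndependent.aevalEquivField_algebraMap_apply_coe, MvPolynomial.aeval_X]
  have hmem : ∀ a : ParamField F m, algebraMap _ Ω a ∈ N := by
    intro a
    obtain ⟨p, q, -, rfl⟩ := IsFractionRing.div_surjective (A := MvPolynomial (Fin (m + 1)) F) a
    have hp : ∀ p : MvPolynomial (Fin (m + 1)) F,
        algebraMap _ Ω (algebraMap _ (ParamField F m) p) ∈ N := fun p => by
      induction p using MvPolynomial.induction_on with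
      | C c =>
        have : algebraMap _ Ω (algebraMap _ (ParamField F m) (MvPolynomial.C (σ := Fin (m + 1)) c))
          = algebraMap F Ω c := (IsScalarTower.algebraMap_apply F (ParamField F m) Ω c).symm
        rw [this]; exact N.algebraMap_mem c
      | add p q hp hq => rw [map_add, map_add]; exact add_mem hp hq
      | mul_X p j hp =>
        rw [map_mul, map_mul]
        refine mul_mem hp ?_
        obtain ⟨e, he, -⟩ := hz j
        have he' : (e : Ω) = algebraMap _ Ω (algebraMap _ (ParamField F m) (MvPolynomial.X j)) := he
        rw [← he']; exact e.2
    rw [map_div₀]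
    exact div_mem (hp p) (hp q)
  -- F(A) lies in `N` and `ψ` preserves every A_j, so `ψ` is F(A)-linear and extends to `Ω` by
  -- normality.
  let φ : ParamField F m →+* N := (algebraMap (ParamField F m) Ω).codRestrict N hmem
  let _ : Algebra (ParamField F m) N := φ.toAlgebra
  have : IsScalarTower (ParamField F m) N Ω := IsScalarTower.of_algebraMap_eq fun _ => rfl
  have hcomm : (ψ : N →+* Ω).comp φ = algebraMap (ParamField F m) Ω := by
    refine ParamField.ringHom_ext (fun c => ?_) fun j => ?_
    · have : φ (algebraMap F _ c) = algebraMap F N c :=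
        Subtype.ext (IsScalarTower.algebraMap_apply F (ParamField F m) Ω c).symm
      rw [RingHom.comp_apply, this, ← IsScalarTower.algebraMap_apply]
      exact ψ.commutes c
    · obtain ⟨e, he, he'⟩ := hz j
      have : φ (paramVar F m j) = e := Subtype.ext he.symm
      rw [RingHom.comp_apply, this]
      exact he' ψ hψ
  let ψ' : N →ₐ[ParamField F m] Ω :=
    { (ψ : N →+* Ω) with commutes' := fun a => RingHom.congr_fun hcomm a }
  let σ := ψ'.liftNormal Ω
  refine ⟨AlgEquiv.ofBijective σ (AlgHom.normal_bijective _ Ω Ω σ), fun i => ?_⟩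
  have := ψ'.liftNormal_commutes Ω ⟨z i, IntermediateField.subset_adjoin F _ ⟨i, rfl⟩⟩
  exact this.trans (hψ i)

end Generic

/-! ### Double transitivity and separability. -/

section Transitivity

variable {F : Type*} [Field F]

theorem LinearFunction.aeval_eval_genericPerturbation (L : LinearFunction F) (m : ℕ) (f₀ : F[X])
    {Ω : Type*} [Field Ω] [Algebra F Ω] [Algebra (ParamField F m) Ω]
    [IsScalarTower F (ParamField F m) Ω] (x : Ω) :
    aeval x (L.eval (genericPerturbation m f₀)) = aeval x L.a + aeval x L.b *
      (aeval x f₀ + ∑ j : Fin (m + 1), algebraMap _ Ω (paramVar F m j) * x ^ (j : ℕ)) := by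
  simp [LinearFunction.eval, genericPerturbation, aeval_map_algebraMap]

/-- If `b` vanished at `x`, so would `a`, against the Bézout relation. Hence f = -a/b makes sense at
a root. -/
theorem LinearFunction.IsPrimitive.aeval_b_ne_zero {L : LinearFunction F} (hL : L.IsPrimitive)
    {Ω : Type*} [Field Ω] [Algebra F Ω] {x c : Ω} (h : aeval x L.a + aeval x L.b * c = 0) :
    aeval x L.b ≠ 0 := by
  intro hb
  rw [hb, zero_mul, add_zero] at h
  obtain ⟨u, v, huv⟩ := hL
  have := congrArg (aeval x) huv
  simp [h, hb] at this

/-- The part of `f(t)` that is linear in `t`, if `f(t) = -a(t)/b(t)`. -/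
noncomputable def linearPart {l : ℕ} {N : Type*} [Field N] [Algebra F N] (L : LinearFunction F)
    (f₀ : F[X]) (z : Fin l → N) (t : N) : N :=
  -(aeval t L.a / aeval t L.b) - aeval t f₀ - ∑ j : Fin l, z j * t ^ ((j : ℕ) + 2)

theorem map_linearPart {l : ℕ} {N N' : Type*} [Field N] [Algebra F N] [Field N'] [Algebra F N']
    (L : LinearFunction F) (f₀ : F[X]) (z : Fin l → N) (t : N) (ψ : N →ₐ[F] N') :
    ψ (linearPart L f₀ z t) = linearPart L f₀ (ψ ∘ z) (ψ t) := by
  simp [linearPart, aeval_algHom_apply]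

/-- The coefficients of `f` in terms of the two elements `z 0`, `z 1` with `f = -a/b` there, and of
the coefficients `z 2, z 3, …` of `t^2, t^3, …`. -/
noncomputable def solveCoeffs {l : ℕ} {N : Type*} [Field N] [Algebra F N] (L : LinearFunction F)
    (f₀ : F[X]) (z : Fin (l + 2) → N) : Fin (l + 2) → N :=
  let ρ := linearPart L f₀ fun j => z j.succ.succ
  let s := (ρ (z 0) - ρ (z 1)) / (z 0 - z 1)
  Fin.cons (ρ (z 0) - s * z 0) (Fin.cons s fun j => z j.succ.succ)

/-- The formulas are rational over `F`, so they commute with embeddings; this supplies the condition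
on `ψ` in `exists_algEquiv_map_eq_of_paramVar_eq`. -/
theorem map_solveCoeffs {l : ℕ} {N N' : Type*} [Field N] [Algebra F N] [Field N'] [Algebra F N']
    (L : LinearFunction F) (f₀ : F[X]) (z : Fin (l + 2) → N) (ψ : N →ₐ[F] N') (j : Fin (l + 2)) :
    ψ (solveCoeffs L f₀ z j) = solveCoeffs L f₀ (ψ ∘ z) j := by
  refine Fin.cases ?_ (fun j => Fin.cases ?_ (fun j => ?_) j) j
  · simp [solveCoeffs, map_linearPart, Function.comp_def]
  · simp [solveCoeffs, map_linearPart, Function.comp_def]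
  · simp [solveCoeffs]

theorem solveCoeffs_mem_adjoin {l : ℕ} {Ω : Type*} [Field Ω] [Algebra F Ω]
    (L : LinearFunction F) (f₀ : F[X]) (z : Fin (l + 2) → Ω) (j : Fin (l + 2)) :
    solveCoeffs L f₀ (fun i => (⟨z i, IntermediateField.subset_adjoin F _ ⟨i, rfl⟩⟩ :
      IntermediateField.adjoin F (Set.range z))) j = solveCoeffs L f₀ z j :=
  map_solveCoeffs L f₀ _ (IntermediateField.adjoin F (Set.range z)).val j

/-- A pair of elements, followed by the variables `A_2, A_3, …`. -/
noncomputable def pairFamily (F : Type*) [Field F] {l : ℕ} {Ω : Type*} [Field Ω]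
    [Algebra (ParamField F (l + 1)) Ω] (x y : Ω) : Fin (l + 2) → Ω :=
  Fin.cons x (Fin.cons y fun j : Fin l => algebraMap _ Ω (paramVar F (l + 1) j.succ.succ))

section

variable {l : ℕ} {Ω : Type*} [Field Ω] [Algebra F Ω] [Algebra (ParamField F (l + 1)) Ω]
  [IsScalarTower F (ParamField F (l + 1)) Ω]

theorem linear_eq_of_aeval_eq_zero {L : LinearFunction F} (hL : L.IsPrimitive) (f₀ : F[X]) {x : Ω}
    (hx : aeval x (L.eval (genericPerturbation (l + 1) f₀)) = 0) :
    algebraMap _ Ω (paramVar F (l + 1) 0) + algebraMap _ Ω (paramVar F (l + 1) 1) * x =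
      linearPart L f₀ (fun j : Fin l => algebraMap _ Ω (paramVar F (l + 1) j.succ.succ)) x := by
  rw [L.aeval_eval_genericPerturbation] at hx
  have hb := hL.aeval_b_ne_zero hx
  rw [Fin.sum_univ_succ, Fin.sum_univ_succ] at hx
  simp only [Fin.val_zero, pow_zero, mul_one, Fin.val_succ, Fin.succ_zero_eq_one, Fin.val_one,
    pow_one, add_assoc, one_add_one_eq_two] at hx
  rw [linearPart]
  field_simp
  linear_combination hx

/-- Linear interpolation: A_0 + A_1 t is determined by its values at two distinct points, with A_1
the difference quotient. -/
theorem solveCoeffs_pairFamily {L : LinearFunction F} (hL : L.IsPrimitive) (f₀ : F[X]) {x y : Ω}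
    (hxy : x ≠ y) (hx : aeval x (L.eval (genericPerturbation (l + 1) f₀)) = 0)
    (hy : aeval y (L.eval (genericPerturbation (l + 1) f₀)) = 0) (j : Fin (l + 2)) :
    solveCoeffs L f₀ (pairFamily F x y) j = algebraMap _ Ω (paramVar F (l + 1) j) := by
  have hx' := linear_eq_of_aeval_eq_zero hL f₀ hx
  have hy' := linear_eq_of_aeval_eq_zero hL f₀ hy
  have hne : x - y ≠ 0 := sub_ne_zero.mpr hxy
  have hs : algebraMap _ Ω (paramVar F (l + 1) 1) =
      (linearPart L f₀ (fun j : Fin l => algebraMap _ Ω (paramVar F (l + 1) j.succ.succ)) x -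
        linearPart L f₀ (fun j : Fin l => algebraMap _ Ω (paramVar F (l + 1) j.succ.succ)) y) /
        (x - y) := by
    rw [eq_div_iff hne, ← hx', ← hy']; ring
  have h0 : pairFamily (l := l) F x y 0 = x := rfl
  have h1 : pairFamily (l := l) F x y 1 = y := rfl
  have h2 : (fun j : Fin l => pairFamily F x y j.succ.succ) =
    fun j : Fin l => algebraMap _ Ω (paramVar F (l + 1) j.succ.succ) := rfl
  refine Fin.cases ?_ (fun j => Fin.cases ?_ (fun j => ?_) j) j
  · simp only [solveCoeffs, Fin.cons_zero, h0, h1, h2]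
    rw [← hs, ← hx']; ring
  · simp only [solveCoeffs, Fin.cons_zero, Fin.cons_succ, h0, h1, h2]
    rw [← hs]; rfl
  · rfl

/-- The Galois group of `L(f)` acts doubly transitively on the roots. -/
theorem exists_algEquiv_map_pair [Normal (ParamField F (l + 1)) Ω] {L : LinearFunction F}
    (hL : L.IsPrimitive) (f₀ : F[X]) {x y x' y' : Ω} (hxy : x ≠ y) (hxy' : x' ≠ y')
    (hx : aeval x (L.eval (genericPerturbation (l + 1) f₀)) = 0)
    (hy : aeval y (L.eval (genericPerturbation (l + 1) f₀)) = 0)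
    (hx' : aeval x' (L.eval (genericPerturbation (l + 1) f₀)) = 0)
    (hy' : aeval y' (L.eval (genericPerturbation (l + 1) f₀)) = 0) :
    ∃ σ : Gal(Ω/ParamField F (l + 1)), σ x = x' ∧ σ y = y' := by
  obtain ⟨σ, hσ⟩ := exists_algEquiv_map_eq_of_paramVar_eq (m := l + 1) (F := F)
    (pairFamily F x y) (pairFamily F x' y') (fun j => by
      refine ⟨_, (solveCoeffs_mem_adjoin L f₀ _ j).trans
        (solveCoeffs_pairFamily hL f₀ hxy hx hy j), fun ψ hψ => ?_⟩
      rw [map_solveCoeffs, ← solveCoeffs_pairFamily hL f₀ hxy' hx' hy' j]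
      congr 1
      funext i
      exact hψ i) fun j => by
        rw [← solveCoeffs_pairFamily hL f₀ hxy' hx' hy' j, ← solveCoeffs_mem_adjoin]
        exact Subtype.property _
  exact ⟨σ, hσ 0, hσ 1⟩

end

/-- `L(f)` has no multiple roots. -/
theorem LinearFunction.IsPrimitive.aeval_derivative_ne_zero {L : LinearFunction F}
    (hL : L.IsPrimitive) {l : ℕ} (f₀ : F[X]) {Ω : Type*} [Field Ω] [Algebra F Ω]
    [Algebra (ParamField F (l + 1)) Ω] [IsScalarTower F (ParamField F (l + 1)) Ω]
    [Algebra.IsAlgebraic (ParamField F (l + 1)) Ω] {x : Ω}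
    (hx : aeval x (L.eval (genericPerturbation (l + 1) f₀)) = 0) :
    aeval x (derivative (L.eval (genericPerturbation (l + 1) f₀))) ≠ 0 := by
  intro hx'
  have hlin := linear_eq_of_aeval_eq_zero hL f₀ hx
  rw [L.aeval_eval_genericPerturbation] at hx
  have hb := hL.aeval_b_ne_zero hx
  have hder : aeval x (derivative (L.eval (genericPerturbation (l + 1) f₀))) =
      aeval x (derivative L.a) + aeval x (derivative L.b) *
      (aeval x f₀ + ∑ j : Fin (l + 2), algebraMap _ Ω (paramVar F (l + 1) j) * x ^ (j : ℕ)) +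
      aeval x L.b * (aeval x (derivative f₀) +
        ∑ j : Fin (l + 2), algebraMap _ Ω (paramVar F (l + 1) j) * (j : ℕ) * x ^ ((j : ℕ) - 1)) := by
    simp only [LinearFunction.eval, genericPerturbation, derivative_mul,
      derivative_map, derivative_C, derivative_X_pow, map_add, map_mul, map_sum,
      aeval_map_algebraMap, aeval_C, map_pow, aeval_X, map_natCast, zero_mul, zero_add]
    simp only [mul_assoc]
    ring
  have hc : aeval x f₀ + ∑ j : Fin (l + 2), algebraMap _ Ω (paramVar F (l + 1) j) * x ^ (j : ℕ) =
      -(aeval x L.a / aeval x L.b) := by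
    rw [← neg_div, eq_div_iff hb]
    linear_combination hx
  rw [hx', hc, eq_comm, Fin.sum_univ_succ, Fin.sum_univ_succ] at hder
  simp only [Fin.val_zero, Nat.cast_zero, mul_zero, zero_mul, zero_add, Fin.val_succ,
    Fin.succ_zero_eq_one, Fin.val_one, Nat.cast_one, mul_one, Nat.sub_self, pow_zero] at hder
  -- The second slot is padded with 0, so `z` cannot be algebraically independent. Yet A_1 is
  -- obtained from the vanishing derivative and A_0 from f(x) = -a/b, both as rational functions of
  -- `z`.
  let z : Fin (l + 2) → Ω := pairFamily F x 0
  have hzmem : ∀ i, z i ∈ IntermediateField.adjoin F (Set.range z) := fun i =>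
    IntermediateField.subset_adjoin F _ ⟨i, rfl⟩
  have hxmem : x ∈ IntermediateField.adjoin F (Set.range z) := hzmem 0
  have hAmem : ∀ j : Fin l, algebraMap _ Ω (paramVar F (l + 1) j.succ.succ) ∈
      IntermediateField.adjoin F (Set.range z) := fun j => hzmem j.succ.succ
  have haeval : ∀ q : F[X], aeval x q ∈ IntermediateField.adjoin F (Set.range z) := fun q => by
    have := (aeval (⟨x, hxmem⟩ : IntermediateField.adjoin F (Set.range z)) q).2
    have h2 := aeval_algHom_apply (IntermediateField.adjoin F (Set.range z)).val
      (⟨x, hxmem⟩ : IntermediateField.adjoin F (Set.range z)) q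
    exact h2 ▸ this
  have h1 : algebraMap _ Ω (paramVar F (l + 1) 1) ∈ IntermediateField.adjoin F (Set.range z) := by
    have : algebraMap _ Ω (paramVar F (l + 1) 1) =
        -((aeval x (derivative L.a) + aeval x (derivative L.b) * -(aeval x L.a / aeval x L.b)) /
          aeval x L.b) - aeval x (derivative f₀) -
          ∑ j : Fin l, algebraMap _ Ω (paramVar F (l + 1) j.succ.succ) * (((j : ℕ) + 1 + 1 : ℕ) : Ω)
            * x ^ ((j : ℕ) + 1 + 1 - 1) := by
      field_simp
      field_simp at hder
      linear_combination hder
    rw [this]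
    refine sub_mem (sub_mem (neg_mem (div_mem (add_mem (haeval _) (mul_mem (haeval _)
      (neg_mem (div_mem (haeval _) (haeval _))))) (haeval _))) (haeval _)) (sum_mem fun j _ => ?_)
    exact mul_mem (mul_mem (hAmem j) (natCast_mem _ _)) (pow_mem hxmem _)
  have h0 : algebraMap _ Ω (paramVar F (l + 1) 0) ∈ IntermediateField.adjoin F (Set.range z) := by
    rw [eq_sub_of_add_eq hlin, linearPart]
    exact sub_mem (sub_mem (sub_mem (neg_mem (div_mem (haeval _) (haeval _))) (haeval _))
      (sum_mem fun j _ => mul_mem (hAmem j) (pow_mem hxmem _))) (mul_mem h1 hxmem)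
  have hind : AlgebraicIndependent F z := algebraicIndependent_of_paramVar_mem_adjoin z
    fun j => Fin.cases h0 (fun j => Fin.cases h1 hAmem j) j
  exact hind.ne_zero 1 rfl

theorem LinearFunction.IsPrimitive.separable_eval_genericPerturbation {L : LinearFunction F}
    (hL : L.IsPrimitive) (l : ℕ) (f₀ : F[X]) :
    (L.eval (genericPerturbation (l + 1) f₀)).Separable := by
  rw [Polynomial.Separable, isCoprime_iff_aeval_ne_zero_of_isAlgClosed _
    (AlgebraicClosure (ParamField F (l + 1)))]
  intro x
  by_contra! h
  exact hL.aeval_derivative_ne_zero f₀ h.1 h.2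

end Transitivity

/-! ### Pencils of polynomials, Wronskians and the trapezoidal rule. -/

section Pencil

variable {F : Type*} [Field F]

/-- A pencil spanned by two coprime polynomials with nonzero Wronskian has only finitely many
inseparable members. -/
theorem finite_not_separable_add_C_mul [IsAlgClosed F] {w b : F[X]} (h : IsCoprime w b)
    (hW : w * derivative b - derivative w * b ≠ 0) :
    {A : F | ¬ (w + C A * b).Separable}.Finite := by
  classical
  -- At a multiple root y of w + A b the Wronskian vanishes, and y determines A = -w(y)/b(y).
  refine ((w * derivative b - derivative w * b).roots.toFinset.image
    fun y => -(w.eval y / b.eval y)).finite_toSet.subset ?_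
  intro A hA
  rw [Set.mem_ofPred_eq, Polynomial.Separable, isCoprime_iff_aeval_ne_zero_of_isAlgClosed F F] at hA
  push Not at hA
  obtain ⟨y, h1, h2⟩ := hA
  simp only [derivative_add, derivative_mul, derivative_C, zero_mul, zero_add, coe_aeval_eq_eval,
    eval_add, eval_mul, eval_C] at h1 h2
  have hb : b.eval y ≠ 0 := by
    intro hb
    obtain ⟨c, d, hcd⟩ := h
    have hw : w.eval y = 0 := by simpa [hb] using h1
    simpa [hb, hw] using congrArg (eval y) hcd
  rw [Finset.mem_coe, Finset.mem_image]
  refine ⟨y, ?_, ?_⟩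
  · rw [Multiset.mem_toFinset, mem_roots hW, IsRoot.def, eval_sub, eval_mul, eval_mul]
    linear_combination (derivative b).eval y * h1 - b.eval y * h2
  · field_simp
    linear_combination -h1

/-- Either `b * g` has smaller degree, or `hc` excludes cancellation of the top terms. Only a bound
on the degree of `g` is needed, so its coefficient at `d` may be zero. -/
theorem natDegree_add_mul_eq {u b g : F[X]} {d : ℕ} (hg : g.natDegree ≤ d)
    (hd : b.natDegree + d ≤ u.natDegree) (hc : u.leadingCoeff + b.leadingCoeff * g.coeff d ≠ 0) :
    (u + b * g).natDegree = u.natDegree := by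
  rcases hd.lt_or_eq with hlt | heq
  · refine natDegree_add_eq_left_of_natDegree_lt (lt_of_le_of_lt ?_ hlt)
    exact natDegree_mul_le.trans (by omega)
  · refine le_antisymm ?_ ?_
    · exact natDegree_add_le_of_degree_le le_rfl (natDegree_mul_le.trans (by omega))
    · refine le_natDegree_of_ne_zero ?_
      rw [coeff_add, ← heq, coeff_mul_add_eq_of_natDegree_le le_rfl hg, heq]
      exact hc

/-- A polynomial with a double zero. -/
theorem exists_eq_X_sub_C_sq_mul {P : F[X]} {x : F} (h0 : P.eval x = 0)
    (h1 : (derivative P).eval x = 0) : ∃ w, P = (X - C x) ^ 2 * w := by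
  obtain ⟨P₁, rfl⟩ := dvd_iff_isRoot.mpr h0
  obtain ⟨w, rfl⟩ : X - C x ∣ P₁ := by
    rw [dvd_iff_isRoot]
    simpa using h1
  exact ⟨w, by ring⟩

/-- The derivative of the rational function `u / b`. -/
noncomputable def quotDeriv (u b : F[X]) (t : F) : F :=
  ((derivative u).eval t * b.eval t - u.eval t * (derivative b).eval t) / b.eval t ^ 2

/-- A rational function satisfying the trapezoidal rule is a quadratic polynomial. -/
theorem eq_mul_of_trapezoidal (h2 : (2 : F) ≠ 0) [Infinite F] {u b : F[X]} {T : Set F}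
    (hT : Tᶜ.Finite) (hb : ∀ t ∈ T, b.eval t ≠ 0)
    (h : ∀ t ∈ T, ∀ x ∈ T, (quotDeriv u b t + quotDeriv u b x) * (t - x) =
      2 * (u.eval t / b.eval t - u.eval x / b.eval x)) :
    ∃ Q : F[X], Q.natDegree ≤ 2 ∧ u = Q * b := by
  have hTinf : T.Infinite := by
    have := hT.infinite_compl
    rwa [compl_compl] at this
  obtain ⟨x, hx⟩ := hTinf.nonempty
  obtain ⟨z, hz, hzx⟩ := hTinf.exists_notMem_finite (Set.finite_singleton x)
  have hzx' : z - x ≠ 0 := sub_ne_zero.mpr hzx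
  let c := (quotDeriv u b z - quotDeriv u b x) / (z - x)
  -- The rule is added over the three pairs from t, x, z: the right sides telescope to 0, which
  -- makes the derivative affine. Substituting this back gives the quadratic without integrating, so
  -- positive characteristic is no obstacle.
  have hlin : ∀ t ∈ T, quotDeriv u b t = quotDeriv u b x + c * (t - x) := fun t ht => by
    have h1 := h t ht x hx
    have h3 := h x hx z hz
    have h4 := h z hz t ht
    simp only [c]
    field_simp
    linear_combination h1 + h3 + h4
  refine ⟨C (u.eval x / b.eval x) + C (quotDeriv u b x) * (X - C x) + C (c / 2) * (X - C x) ^ 2,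
    by compute_degree, ?_⟩
  refine eq_of_infinite_eval_eq _ _ (hTinf.mono fun t ht => ?_)
  have h1 := h t ht x hx
  rw [hlin t ht] at h1
  have hbt := hb t ht
  have h5 : u.eval t / b.eval t = u.eval x / b.eval x + quotDeriv u b x * (t - x) +
      c / 2 * (t - x) ^ 2 := by
    field_simp at h1 ⊢
    linear_combination -h1
  simp only [Set.mem_ofPred_eq, eval_mul, eval_add, eval_C, eval_sub, eval_X, eval_pow]
  rw [← h5]
  field_simp

/-- The Wronskian of `b` and the second-order remainder of `u / b` at `x`, times `b`. -/
theorem wronskian_remainder {u b w : F[X]} {x t : F} (hbt : b.eval t ≠ 0)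
    (hw : u + b * (C (-(u.eval x / b.eval x)) + C (-quotDeriv u b x) * (X - C x)) =
      (X - C x) ^ 2 * w) :
    (t - x) ^ 3 * (w * derivative b - derivative w * b).eval t =
      -(b.eval t) ^ 2 * ((quotDeriv u b t + quotDeriv u b x) * (t - x) -
        2 * (u.eval t / b.eval t - u.eval x / b.eval x)) := by
  have h0 := congrArg (eval t) hw
  have h1 := congrArg (fun p => eval t (derivative p)) hw
  simp only [derivative_add, derivative_mul, derivative_C, derivative_sub, derivative_X,
    derivative_X_sub_C_sq, eval_add, eval_mul, eval_C, eval_sub, eval_X, eval_pow, zero_mul,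
    zero_add, sub_zero, mul_one] at h0 h1
  rw [quotDeriv.eq_1 u b t]
  generalize quotDeriv u b x = ρ at *
  generalize u.eval x / b.eval x = r at *
  simp only [eval_sub, eval_mul]
  field_simp
  linear_combination -((t - x) * (derivative b).eval t + 2 * b.eval t) * h0 +
    (t - x) * b.eval t * h1

end Pencil

/-! ### A specialization with exactly one double root. -/

section Specialization

variable {F : Type*} [Field F]

/-- If the Wronskian vanished for all admissible `x`, `wronskian_remainder` would give the
trapezoidal rule for u/b, hence u = Q b with deg Q ≤ 2; coprimality then makes `b` constant, against
deg u > 2. -/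
theorem exists_wronskian_remainder_ne_zero (h2 : (2 : F) ≠ 0) [Infinite F] {u b : F[X]}
    (hub : IsCoprime u b) (hb : b ≠ 0) (hu : 2 < u.natDegree) {S : Set F} (hS : S.Finite) :
    ∃ x ∉ S, b.eval x ≠ 0 ∧ ∀ w,
      u + b * (C (-(u.eval x / b.eval x)) + C (-quotDeriv u b x) * (X - C x)) =
        (X - C x) ^ 2 * w → w * derivative b - derivative w * b ≠ 0 := by
  by_contra! hcon
  have hbfin : {t | b.eval t = 0}.Finite := finite_setOfPred_isRoot hb
  obtain ⟨Q, hQ, rfl⟩ := eq_mul_of_trapezoidal h2 (u := u) (b := b)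
    (T := {t | t ∉ S ∧ b.eval t ≠ 0})
    ((hS.union hbfin).subset fun t ht => by
      by_cases htS : t ∈ S
      · exact Or.inl htS
      · exact Or.inr (not_not.mp fun h => ht ⟨htS, h⟩))
    (fun t ht => ht.2) (fun t ht x hx => by
      obtain ⟨w, hw, hW⟩ := hcon x hx.1 hx.2
      have := wronskian_remainder ht.2 hw
      rw [hW, eval_zero, mul_zero, eq_comm, mul_eq_zero] at this
      exact sub_eq_zero.mp (this.resolve_left (neg_ne_zero.mpr (pow_ne_zero 2 ht.2))))
  have hunit : IsUnit b := hub.isUnit_of_dvd' (dvd_mul_left b Q) dvd_rfl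
  have := natDegree_mul_le (p := Q) (q := b)
  rw [natDegree_eq_zero_of_isUnit hunit] at this
  omega

theorem LinearFunction.eval_self (L : LinearFunction F) (f : F[X]) : L.eval f = L.a + L.b * f := by
  simp [LinearFunction.eval]

/-- A fraction a/b in lowest terms determines a and b up to a unit. -/
theorem LinearFunction.isAssociated_of_mul_eq {L L' : LinearFunction F} (hL : L.IsPrimitive)
    (hL' : L'.IsPrimitive) (h : L'.a * L.b = L'.b * L.a) : L.IsAssociated L' := by
  have h1 : L.b ∣ L'.b := (IsCoprime.symm hL).dvd_of_dvd_mul_right ⟨L'.a, by rw [← h]; ring⟩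
  have h3 : L'.b ∣ L.b := (IsCoprime.symm hL').dvd_of_dvd_mul_left ⟨L.a, h⟩
  obtain ⟨v, hv⟩ := associated_of_dvd_dvd h1 h3
  obtain ⟨c, hc, hcv⟩ := Polynomial.isUnit_iff.mp v.isUnit
  refine ⟨c, hc.ne_zero, ?_, ?_⟩
  · refine mul_right_cancel₀ L.b_ne_zero ?_
    rw [h, ← hv, ← hcv]; ring
  · rw [← hv, ← hcv]; ring

/-- There is a specialization of `f` for which `L_i(f)` acquires exactly one double root, while the
other `L_j(f)` remain separable. -/
theorem exists_specialization [IsAlgClosed F] (h2 : (2 : F) ≠ 0) {n m : ℕ} (hm : 2 ≤ m)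
    (L : Fin n → LinearFunction F) (hprim : ∀ i, (L i).IsPrimitive)
    (hdist : ∀ i j, i ≠ j → ¬ (L i).IsAssociated (L j)) (f₀ : F[X])
    (hcancel : ∀ i, (L i).b.natDegree + m ≤ ((L i).eval f₀).natDegree) (i : Fin n) :
    ∃ (α : Fin (m + 1) → F) (x : F) (q : F[X]),
      (∀ j, ((L j).eval (f₀ + ∑ l, C (α l) * X ^ (l : ℕ))).natDegree =
        ((L j).eval f₀).natDegree) ∧
      (∀ j, j ≠ i → ((L j).eval (f₀ + ∑ l, C (α l) * X ^ (l : ℕ))).Separable) ∧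
      (L i).eval (f₀ + ∑ l, C (α l) * X ^ (l : ℕ)) = (X - C x) ^ 2 * q ∧ q.Separable ∧
      q.eval x ≠ 0 ∧ (L i).b.eval x ≠ 0 := by
  have : Infinite F := IsAlgClosed.instInfinite
  simp only [LinearFunction.eval_self] at hcancel ⊢
  set u := (L i).a + (L i).b * f₀ with hu
  set b := (L i).b with hb
  have hb0 : b ≠ 0 := (L i).b_ne_zero
  have hub : IsCoprime u b := (hprim i).add_mul_left_left f₀
  -- Off the zeros of `Φ j`, L_j(f) does not vanish at `x` when L_i(f) does, and b_j is nonzero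
  -- there. The value 1 at `i` keeps the product nonzero.
  let Φ : Fin n → F[X] := fun j => if j = i then 1 else (L j).b * ((L j).a * b - (L j).b * (L i).a)
  have hΦ : ∀ j, Φ j ≠ 0 := fun j => by
    by_cases hji : j = i
    · simp [Φ, hji]
    · simp only [Φ, hji, if_false]
      refine mul_ne_zero (L j).b_ne_zero (sub_ne_zero.mpr fun h => ?_)
      exact hdist i j (Ne.symm hji)
        (LinearFunction.isAssociated_of_mul_eq (hprim i) (hprim j) h)
  have hfin : ∀ {p : F[X]}, p ≠ 0 → {t | p.eval t = 0}.Finite := fun hp =>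
    finite_setOfPred_isRoot hp
  have hP : b * ∏ j, Φ j ≠ 0 := mul_ne_zero hb0 (Finset.prod_ne_zero_iff.mpr fun j _ => hΦ j)
  obtain ⟨x, hxS, hbx, hW⟩ : ∃ x ∉ {t | (b * ∏ j, Φ j).eval t = 0}, b.eval x ≠ 0 ∧
      (2 < u.natDegree → ∀ w,
        u + b * (C (-(u.eval x / b.eval x)) + C (-quotDeriv u b x) * (X - C x)) =
        (X - C x) ^ 2 * w → w * derivative b - derivative w * b ≠ 0) := by
    by_cases hdeg : 2 < u.natDegree
    · obtain ⟨x, h1, h3, h4⟩ := exists_wronskian_remainder_ne_zero h2 hub hb0 hdeg (hfin hP)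
      exact ⟨x, h1, h3, fun _ => h4⟩
    · obtain ⟨x, hx⟩ := (hfin hP).exists_notMem
      refine ⟨x, hx, fun h => hx ?_, fun h => absurd h hdeg⟩
      simp [h]
  have hΦx : ∀ j, (Φ j).eval x ≠ 0 := fun j h => hxS <| by
    rw [Set.mem_ofPred_eq, eval_mul, eval_prod,
      Finset.prod_eq_zero (Finset.mem_univ j) h, mul_zero]
  -- `α` and `β` are the value and derivative of -u/b at `x`: they force the double zero.
  set α := -(u.eval x / b.eval x) with hα
  set β := -quotDeriv u b x with hβ
  obtain ⟨w, hw⟩ := exists_eq_X_sub_C_sq_mul (P := u + b * (C α + C β * (X - C x))) (x := x)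
    (by simp only [eval_add, eval_mul, eval_C, eval_sub, eval_X, sub_self, mul_zero, add_zero, hα]
        field_simp
        ring)
    (by simp only [derivative_add, derivative_mul, derivative_C, derivative_sub, derivative_X,
          eval_add, eval_mul, eval_C, eval_sub, eval_X, sub_self, mul_zero, add_zero, zero_mul,
          zero_add, sub_zero, mul_one, hα, hβ, quotDeriv]
        field_simp
        ring)
  have hwb : IsCoprime w b := by
    have h1 : IsCoprime (u + b * (C α + C β * (X - C x))) b := hub.add_mul_left_left _
    rw [hw] at h1
    exact h1.of_mul_left_right
  -- The conditions on the coefficient of `(t - x)^2`.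
  let v : Fin n → F[X] := fun j => (L j).a + (L j).b * f₀ + (L j).b * (C α + C β * (X - C x))
  have hvx : ∀ j, j ≠ i → (v j).eval x ≠ 0 ∧ (L j).b.eval x ≠ 0 := fun j hji => by
    have h := hΦx j
    simp only [Φ, hji, if_false, eval_mul, eval_sub] at h
    refine ⟨fun hv => h ?_, left_ne_zero_of_mul h⟩
    simp only [v, eval_add, eval_mul, eval_C, eval_sub, eval_X, sub_self, mul_zero, add_zero, hα,
      hu] at hv
    field_simp at hv
    rw [mul_eq_zero]
    right
    linear_combination hv
  have hsepj : ∀ j, j ≠ i → {A : F | ¬ (v j + C A * ((L j).b * (X - C x) ^ 2)).Separable}.Finite :=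
    fun j hji => by
    obtain ⟨hv, hbj⟩ := hvx j hji
    refine finite_not_separable_add_C_mul ?_ ?_
    · refine IsCoprime.mul_right ?_ ?_
      · exact ((hprim j).add_mul_left_left _).add_mul_left_left _
      · refine IsCoprime.pow_right (IsCoprime.symm ?_)
        exact ((irreducible_X_sub_C x).coprime_iff_not_dvd).mpr (mt dvd_iff_isRoot.mp hv)
    · intro h
      -- The Wronskian of the pencil divided by X - x; at `x` it is 2 v_j b_j, nonzero as the
      -- characteristic is not 2.
      have h1 : (v j * (L j).b * 2 + (X - C x) * (v j * derivative (L j).b -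
          derivative (v j) * (L j).b)) = 0 := by
        refine mul_left_cancel₀ (X_sub_C_ne_zero x) ?_
        rw [mul_zero, ← h]
        simp only [derivative_mul, derivative_X_sub_C_sq]
        rw [C_ofNat]
        ring
      have h3 := congrArg (eval x) h1
      simp only [eval_add, eval_mul, eval_sub, eval_X, eval_C, sub_self, zero_mul, add_zero,
        eval_ofNat, eval_zero, mul_eq_zero] at h3
      rcases h3 with (h3 | h3) | h3
      · exact hv h3
      · exact hbj h3
      · exact h2 h3
  have hdegfin : ∀ j, {A : F | ((L j).a + (L j).b * f₀).leadingCoeff +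
      (L j).b.leadingCoeff * A = 0}.Finite := fun j => by
    refine (Set.finite_singleton (-((L j).a + (L j).b * f₀).leadingCoeff /
      (L j).b.leadingCoeff)).subset fun A hA => ?_
    have : (L j).b.leadingCoeff ≠ 0 := leadingCoeff_ne_zero.mpr (L j).b_ne_zero
    rw [Set.mem_singleton_iff, eq_div_iff this]
    rw [Set.mem_ofPred_eq] at hA
    linear_combination hA
  have hqx : {A : F | w.eval x + b.eval x * A = 0}.Finite := by
    refine (Set.finite_singleton (-w.eval x / b.eval x)).subset fun A hA => ?_
    rw [Set.mem_singleton_iff, eq_div_iff hbx]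
    rw [Set.mem_ofPred_eq] at hA
    linear_combination hA
  have hqsep : 2 < u.natDegree → {A : F | ¬ (w + C A * b).Separable}.Finite := fun hd =>
    finite_not_separable_add_C_mul hwb (hW hd w hw)
  obtain ⟨A, hA⟩ := (((Set.finite_iUnion fun j : {j // j ≠ i} => hsepj j j.2).union
    (Set.finite_iUnion hdegfin)).union (hqx.union (Set.finite_iUnion hqsep))).exists_notMem
  simp only [Set.mem_union, Set.mem_iUnion, not_or, not_exists, Set.mem_ofPred_eq, not_not] at hA
  obtain ⟨⟨hA1, hA2⟩, hA3, hA4⟩ := hA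
  let g : F[X] := C α + C β * (X - C x) + C A * (X - C x) ^ 2
  have hgdeg : g.natDegree ≤ 2 := by simp only [g]; compute_degree
  have hg2 : g.coeff 2 = A := by
    have : g = C A * X ^ 2 + C (β - 2 * A * x) * X + C (α - β * x + A * x ^ 2) := by
      simp only [g, C_sub, C_add, C_mul, C_pow, C_ofNat]; ring
    rw [this]
    simp only [coeff_add, coeff_C_mul, coeff_X_pow, coeff_X, coeff_C]
    simp
  have hgsum : ∑ l : Fin (m + 1), C (g.coeff l) * X ^ (l : ℕ) = g := by
    rw [Fin.sum_univ_eq_sum_range (fun l => C (g.coeff l) * X ^ l) (m + 1)]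
    exact (as_sum_range_C_mul_X_pow' (p := g) (by omega)).symm
  have hdegj : ∀ j, ((L j).a + (L j).b * (f₀ + g)).natDegree =
      ((L j).a + (L j).b * f₀).natDegree := fun j => by
    rw [mul_add, ← add_assoc]
    refine natDegree_add_mul_eq hgdeg ((Nat.add_le_add_left hm _).trans (hcancel j)) ?_
    rw [hg2]
    exact hA2 j
  have hfac : (L i).a + b * (f₀ + g) = (X - C x) ^ 2 * (w + C A * b) := by
    rw [mul_add _ w, ← hw, hu]; simp only [g]; ring
  refine ⟨fun l => g.coeff l, x, w + C A * b, ?_⟩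
  rw [hgsum]
  refine ⟨hdegj, fun j hji => ?_, hfac, ?_, ?_, hbx⟩
  · have := hA1 ⟨j, hji⟩
    convert this using 1
    simp only [v, g]; ring
  · by_cases hd : 2 < u.natDegree
    · exact hA4 hd
    -- Here deg u = 2, because deg u ≥ deg b + m ≥ 2, so the cofactor of the square is a nonzero
    -- constant.
    · have h1 : _ = u.natDegree := hdegj i
      have h3 : b.natDegree + m ≤ u.natDegree := hcancel i
      have hq0 : w + C A * b ≠ 0 := by
        intro h0
        rw [hfac, h0] at h1
        simp only [mul_zero, natDegree_zero] at h1
        omega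
      rw [hfac, natDegree_mul (pow_ne_zero 2 (X_sub_C_ne_zero x)) hq0, natDegree_pow,
        natDegree_X_sub_C] at h1
      obtain ⟨c, hc⟩ := natDegree_eq_zero.mp (show (w + C A * b).natDegree = 0 by omega)
      rw [← hc, separable_C]
      refine isUnit_iff_ne_zero.mpr fun h => hq0 ?_
      rw [← hc, h, C_0]
  · rw [eval_add, eval_mul, eval_C, mul_comm]
    exact hA3

end Specialization

/-! ### Hensel's lemma and inertia over the power series. -/

section PowerSeries

universe u

variable {E : Type u} [Field E]

/-- Reduces polynomials with unit leading coefficient to the monic case, which Hensel's lemma and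
integrality require. -/
theorem exists_monic_eq_C_mul {R : Type*} [CommRing R] {p : R[X]} (h : IsUnit p.leadingCoeff) :
    ∃ (c : R) (p' : R[X]), p'.Monic ∧ IsUnit c ∧ p = C c * p' := by
  obtain ⟨c, hc⟩ := h
  refine ⟨c, C (↑c⁻¹ : R) * p, monic_C_mul_of_mul_leadingCoeff_eq_one ?_, c.isUnit, ?_⟩
  · rw [← hc, Units.inv_mul]
  · rw [← mul_assoc, ← C_mul, Units.mul_inv, C_1, one_mul]

theorem isUnit_leadingCoeff_of_natDegree_map {p : (PowerSeries E)[X]}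
    (hdeg : (p.map (PowerSeries.constantCoeff (R := E))).natDegree = p.natDegree)
    (h0 : p.map (PowerSeries.constantCoeff (R := E)) ≠ 0) : IsUnit p.leadingCoeff := by
  rw [PowerSeries.isUnit_iff_constantCoeff, isUnit_iff_ne_zero, leadingCoeff, ← hdeg, ← coeff_map]
  exact leadingCoeff_ne_zero.mpr h0

/-- Hensel's lemma: simple roots lift to power series. -/
theorem exists_powerSeries_root_of_simple_root {p : (PowerSeries E)[X]}
    (hp : IsUnit p.leadingCoeff) {e : E}
    (h0 : (p.map (PowerSeries.constantCoeff (R := E))).eval e = 0)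
    (h1 : (derivative (p.map (PowerSeries.constantCoeff (R := E)))).eval e ≠ 0) :
    ∃ r : PowerSeries E, p.eval r = 0 ∧ PowerSeries.constantCoeff r = e := by
  obtain ⟨c, p', hp', hc, rfl⟩ := exists_monic_eq_C_mul hp
  have hc' : PowerSeries.constantCoeff c ≠ 0 :=
    isUnit_iff_ne_zero.mp (PowerSeries.isUnit_iff_constantCoeff.mp hc)
  have key : ∀ q : (PowerSeries E)[X],
      PowerSeries.constantCoeff (q.eval (PowerSeries.C e)) =
        (q.map (PowerSeries.constantCoeff (R := E))).eval e := fun q => by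
    rw [← eval_map_apply, PowerSeries.constantCoeff_C]
  rw [Polynomial.map_mul, map_C, eval_C_mul] at h0
  rw [Polynomial.map_mul, map_C, derivative_C_mul, eval_C_mul, derivative_map] at h1
  obtain ⟨r, hr, hr'⟩ := HenselianRing.is_henselian
    (I := Ideal.span {(PowerSeries.X : PowerSeries E)})
    p' hp' (PowerSeries.C e) (by
      rw [Ideal.mem_span_singleton, PowerSeries.X_dvd_iff, key]
      exact (mul_eq_zero.mp h0).resolve_left hc') (by
      refine IsUnit.map _ ?_
      rw [PowerSeries.isUnit_iff_constantCoeff, isUnit_iff_ne_zero, key]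
      exact right_ne_zero_of_mul h1)
  refine ⟨r, ?_, ?_⟩
  · rw [eval_mul, hr, mul_zero]
  · rw [Ideal.mem_span_singleton, PowerSeries.X_dvd_iff, map_sub, PowerSeries.constantCoeff_C,
      sub_eq_zero] at hr'
    exact hr'

/-- Lifts of distinct roots are distinct, since their constant terms are. The separate `q` allows it
to be the cofactor of a double root. -/
theorem exists_finset_powerSeries_roots [IsAlgClosed E] {p : (PowerSeries E)[X]}
    (hp : IsUnit p.leadingCoeff) {q : E[X]} (hq : q.Separable)
    (hsimple : ∀ e, q.eval e = 0 → (p.map (PowerSeries.constantCoeff (R := E))).eval e = 0 ∧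
      (derivative (p.map (PowerSeries.constantCoeff (R := E)))).eval e ≠ 0) :
    ∃ T : Finset (PowerSeries E), T.card = q.natDegree ∧ ∀ r ∈ T, p.eval r = 0 := by
  classical
  have hlift : ∀ e, q.eval e = 0 →
      ∃ r : PowerSeries E, p.eval r = 0 ∧ PowerSeries.constantCoeff r = e := fun e he =>
    exists_powerSeries_root_of_simple_root hp (hsimple e he).1 (hsimple e he).2
  choose! l hl hl' using hlift
  have hmem : ∀ e ∈ q.roots.toFinset, q.eval e = 0 := fun e he =>
    isRoot_of_mem_roots (Multiset.mem_toFinset.mp he)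
  refine ⟨q.roots.toFinset.image l, ?_, fun r hr => ?_⟩
  · rw [Finset.card_image_of_injOn, Multiset.toFinset_card_of_nodup (nodup_roots hq)]
    · exact (IsAlgClosed.splits q).natDegree_eq_card_roots.symm
    · intro e he e' he' h
      rw [← hl' e (hmem e he), ← hl' e' (hmem e' he'), h]
  · obtain ⟨e, he, rfl⟩ := Finset.mem_image.mp hr
    exact hl e (hmem e he)

theorem splits_of_finset_roots {K : Type*} [Field K] {p : K[X]} (hp : p ≠ 0)
    (T : Finset K) (hT : ∀ r ∈ T, p.eval r = 0) (hcard : p.natDegree ≤ T.card) : p.Splits := by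
  rw [splits_iff_card_roots]
  refine le_antisymm (card_roots' p) (hcard.trans ?_)
  refine Multiset.card_le_card (s := T.val) ((Multiset.le_iff_subset T.nodup).mpr fun r hr => ?_)
  exact (mem_roots hp).mpr (hT r hr)

theorem splits_of_separable_constantCoeff [IsAlgClosed E] {p : (PowerSeries E)[X]}
    (hdeg : (p.map (PowerSeries.constantCoeff (R := E))).natDegree = p.natDegree)
    (hsep : (p.map (PowerSeries.constantCoeff (R := E))).Separable) {K : Type*} [Field K]
    {ι : PowerSeries E →+* K} (hι : Function.Injective ι) : (p.map ι).Splits := by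
  classical
  have h0 := hsep.ne_zero
  obtain ⟨T, hT, hr⟩ :=
    exists_finset_powerSeries_roots (isUnit_leadingCoeff_of_natDegree_map hdeg h0) hsep
    fun e he => ⟨he, hsep.eval₂_derivative_ne_zero (RingHom.id E) he⟩
  refine splits_of_finset_roots ?_ (T.image ι) (fun r hr' => ?_) ?_
  · rw [Polynomial.map_ne_zero_iff hι]
    rintro rfl
    simp at h0
  · obtain ⟨r, h, rfl⟩ := Finset.mem_image.mp hr'
    rw [eval_map_apply, hr r h, map_zero]
  · rw [Finset.card_image_of_injective _ hι, hT, hdeg]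
    exact natDegree_map_le

/-- A polynomial over the power series with a double root `x` modulo the parameter does not split,
if its value at `x` vanishes only to first order. -/
theorem not_splits_of_double_root_constantCoeff {p : (PowerSeries E)[X]}
    (hp : IsUnit p.leadingCoeff) {x : E}
    (hx : (X - C x) ^ 2 ∣ p.map (PowerSeries.constantCoeff (R := E)))
    (h1 : PowerSeries.coeff 1 (p.eval (PowerSeries.C x)) ≠ 0) :
    ¬ (p.map (algebraMap (PowerSeries E) (FractionRing (PowerSeries E)))).Splits := by
  classical
  intro hs
  have hinj := IsFractionRing.injective (PowerSeries E) (FractionRing (PowerSeries E))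
  have hsplit : p.Splits := by
    -- Roots in the fraction field are integral, hence power series, because the power series ring
    -- is integrally closed.
    refine hs.of_splits_map_of_injective hinj fun y hy => ?_
    have hy0 := isRoot_of_mem_roots hy
    obtain ⟨c, p', hp', hc, rfl⟩ := exists_monic_eq_C_mul hp
    refine IsIntegrallyClosed.isIntegral_iff.mp ⟨p', hp', ?_⟩
    rw [IsRoot.def, Polynomial.map_mul, map_C, eval_mul, eval_C, mul_eq_zero] at hy0
    rw [← eval_map]
    exact hy0.resolve_left ((map_ne_zero_iff _ hinj).mpr hc.ne_zero)
  have hp0 : p.map (PowerSeries.constantCoeff (R := E)) ≠ 0 := by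
    intro h
    have := PowerSeries.isUnit_iff_constantCoeff.mp hp
    rw [leadingCoeff, ← coeff_map, h, coeff_zero] at this
    exact not_isUnit_zero this
  have hroots := hsplit.roots_map_of_ne_zero (φ := PowerSeries.constantCoeff (R := E)) hp0
  have hcount : 2 ≤ (p.roots.filter fun r => x = PowerSeries.constantCoeff r).card := by
    refine le_trans ?_ (Multiset.count_map (PowerSeries.constantCoeff (R := E)) p.roots x).le
    rw [← hroots, count_roots]
    exact (le_rootMultiplicity_iff hp0).mpr hx
  obtain ⟨r₁, r₂, hs1⟩ : ∃ r₁ r₂, ({r₁, r₂} : Multiset (PowerSeries E)) ≤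
      p.roots.filter fun r => x = PowerSeries.constantCoeff r := by
    obtain ⟨r₁, h₁⟩ := Multiset.card_pos_iff_exists_mem.mp (zero_lt_two.trans_le hcount)
    obtain ⟨t, ht⟩ := Multiset.exists_cons_of_mem h₁
    rw [ht, Multiset.card_cons] at hcount
    obtain ⟨r₂, h₂⟩ := Multiset.card_pos_iff_exists_mem.mp (Nat.le_of_succ_le_succ hcount)
    exact ⟨r₁, r₂, ht ▸ Multiset.cons_le_cons r₁ (Multiset.singleton_le.mpr h₂)⟩
  have hle := hs1.trans (Multiset.filter_le _ _)
  have hr : ∀ r ∈ ({r₁, r₂} : Multiset (PowerSeries E)),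
      PowerSeries.X ∣ PowerSeries.C x - r := fun r hr => by
    have := (Multiset.mem_filter.mp (Multiset.mem_of_le hs1 hr)).2
    rw [PowerSeries.X_dvd_iff, map_sub, PowerSeries.constantCoeff_C, this, sub_self]
  -- Two roots with constant term `x` each contribute a factor s to the value at `x`, contradicting
  -- `h1`.
  have hdvd : (PowerSeries.X : PowerSeries E) ^ 2 ∣ p.eval (PowerSeries.C x) := by
    rw [hsplit.eval_eq_prod_roots]
    refine Dvd.dvd.mul_left (dvd_trans ?_ (Multiset.prod_dvd_prod_of_le
      (Multiset.map_le_map hle))) _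
    simp only [Multiset.insert_eq_cons, Multiset.map_cons, Multiset.map_singleton,
      Multiset.prod_cons, Multiset.prod_singleton, pow_two]
    exact mul_dvd_mul (hr r₁ (by simp)) (hr r₂ (by simp))
  exact h1 (PowerSeries.X_pow_dvd_iff.mp hdvd 1 one_lt_two)

/-- The inertia at a simple branch point: if modulo the parameter `p i` has one double root, to
first order, and no other multiple roots, and the other `p j` have only simple roots, then an
automorphism exchanges two roots of `p i` and fixes all other roots. -/
theorem exists_ringEquiv_of_double_root_constantCoeff [IsAlgClosed E] {n : ℕ}
    (p : Fin n → (PowerSeries E)[X])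
    (hdeg : ∀ j, ((p j).map (PowerSeries.constantCoeff (R := E))).natDegree = (p j).natDegree)
    (i : Fin n)
    (hsep : ∀ j, j ≠ i → ((p j).map (PowerSeries.constantCoeff (R := E))).Separable)
    {x : E} {q : E[X]} (hi : (p i).map (PowerSeries.constantCoeff (R := E)) = (X - C x) ^ 2 * q)
    (hq : q.Separable) (hqx : q.eval x ≠ 0)
    (h1 : PowerSeries.coeff 1 ((p i).eval (PowerSeries.C x)) ≠ 0)
    (hsepi : ((p i).map (algebraMap (PowerSeries E) (FractionRing (PowerSeries E)))).Separable) :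
    ∃ (K' : Type u) (_ : Field K') (ι : PowerSeries E →+* K') (σ : K' ≃+* K'),
      Function.Injective ι ∧ (∀ r, σ (ι r) = ι r) ∧ (∀ j, ((p j).map ι).Splits) ∧
      (∀ j, j ≠ i → ∀ y, ((p j).map ι).eval y = 0 → σ y = y) ∧
      (∃ y, ((p i).map ι).eval y = 0 ∧ σ y ≠ y) ∧
      ∃ S : Finset K', (∀ y ∈ S, ((p i).map ι).eval y = 0 ∧ σ y = y) ∧
        (p i).natDegree ≤ S.card + 2 := by
  classical
  let K := FractionRing (PowerSeries E)
  let P : K[X] := (p i).map (algebraMap (PowerSeries E) K)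
  let K' := P.SplittingField
  have hinj : Function.Injective (algebraMap (PowerSeries E) K) := IsFractionRing.injective _ _
  have hinj' : Function.Injective (algebraMap K K') := (algebraMap K K').injective
  let ι : PowerSeries E →+* K' := (algebraMap K K').comp (algebraMap (PowerSeries E) K)
  have hmap : ∀ j, (p j).map ι = ((p j).map (algebraMap (PowerSeries E) K)).map (algebraMap K K') :=
    fun j => (map_map _ _ _).symm
  have hq0 : q ≠ 0 := hq.ne_zero
  have hi0 : (p i).map (PowerSeries.constantCoeff (R := E)) ≠ 0 := by
    rw [hi]; exact mul_ne_zero (pow_ne_zero 2 (X_sub_C_ne_zero x)) hq0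
  have hlc := isUnit_leadingCoeff_of_natDegree_map (hdeg i) hi0
  have hnot := not_splits_of_double_root_constantCoeff hlc (hi ▸ dvd_mul_right _ _) h1
  have hgal : IsGalois K K' := IsGalois.of_separable_splitting_field hsepi
  have hPs : (P.map (algebraMap K K')).Splits := SplittingField.splits P
  -- If every automorphism fixed every root, `P` would split over `K`, which `hnot` excludes.
  obtain ⟨σ, y, hy, hσy⟩ : ∃ (σ : Gal(K'/K)) (y : K'),
      (P.map (algebraMap K K')).eval y = 0 ∧ σ y ≠ y := by
    by_contra! hcon
    refine hnot (hPs.of_splits_map _ fun y hy => ?_)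
    exact (IsGalois.mem_range_algebraMap_iff_fixed y).mpr fun σ =>
      hcon σ y (isRoot_of_mem_roots hy)
  -- The roots of `q` differ from `x`, so they stay simple in (X - x)^2 q; their lifts are all but
  -- two of the roots of `p i`.
  obtain ⟨T, hT, hTr⟩ := exists_finset_powerSeries_roots hlc hq fun e he => by
    rw [hi]
    refine ⟨by rw [eval_mul, he, mul_zero], ?_⟩
    have hne : e ≠ x := by rintro rfl; exact hqx he
    have hq' : (derivative q).eval e ≠ 0 := hq.eval₂_derivative_ne_zero (RingHom.id E) he
    simp only [derivative_mul, eval_add, eval_mul, he, mul_zero, zero_add, eval_pow, eval_sub,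
      eval_X, eval_C]
    exact mul_ne_zero (pow_ne_zero 2 (sub_ne_zero.mpr hne)) hq'
  refine ⟨K', inferInstance, ι, σ.toRingEquiv, hinj'.comp hinj, fun r => σ.commutes _,
    fun j => ?_, fun j hj z hz => ?_, ⟨y, (hmap i).symm ▸ hy, hσy⟩, T.image ι, fun z hz => ?_, ?_⟩
  · by_cases hj : j = i
    · subst hj; rw [hmap]; exact hPs
    · exact splits_of_separable_constantCoeff (hdeg j) (hsep j hj) (hinj'.comp hinj)
  · have hs : ((p j).map (algebraMap (PowerSeries E) K)).Splits :=
      splits_of_separable_constantCoeff (hdeg j) (hsep j hj) hinj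
    have h0 : (p j).map (algebraMap (PowerSeries E) K) ≠ 0 := by
      rw [Polynomial.map_ne_zero_iff hinj]
      intro h
      have := (hsep j hj).ne_zero
      rw [h, Polynomial.map_zero] at this
      exact this rfl
    rw [hmap] at hz
    obtain ⟨w, rfl⟩ := hs.mem_range_of_isRoot h0 hz
    exact σ.commutes w
  · obtain ⟨r, hr, rfl⟩ := Finset.mem_image.mp hz
    refine ⟨?_, σ.commutes _⟩
    rw [eval_map_apply, hTr r hr, map_zero]
  · rw [Finset.card_image_of_injective T (f := ι) (hinj'.comp hinj), hT, ← hdeg i, hi,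
      natDegree_mul (pow_ne_zero 2 (X_sub_C_ne_zero x)) hq0, natDegree_pow, natDegree_X_sub_C]
    omega

end PowerSeries

/-! ### The arc from a special point to the generic point. -/

section Degeneration

variable {F : Type*} [Field F] {m : ℕ}

/-- If the degree bound is attained, the leading coefficient changes by a nonzero multiple of A_m,
which cannot cancel a constant from `F`. -/
theorem natDegree_eval_genericPerturbation (L : LinearFunction F) {f₀ : F[X]}
    (h : L.b.natDegree + m ≤ (L.eval f₀).natDegree) :
    (L.eval (genericPerturbation m f₀)).natDegree = (L.eval f₀).natDegree := by
  rw [LinearFunction.eval_self] at h ⊢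
  let κ := algebraMap F (ParamField F m)
  have hsum : L.eval (genericPerturbation m f₀) = (L.a + L.b * f₀).map κ +
      L.b.map κ * ∑ j : Fin (m + 1), C (paramVar F m j) * X ^ (j : ℕ) := by
    simp only [LinearFunction.eval, genericPerturbation, Polynomial.map_add, Polynomial.map_mul, κ]
    ring
  rw [hsum, natDegree_add_mul_eq (d := m), natDegree_map]
  · refine natDegree_sum_le_of_forall_le _ _ fun j _ => ?_
    exact (natDegree_C_mul_X_pow_le _ _).trans (Nat.lt_succ_iff.mp j.2)
  · rwa [natDegree_map, natDegree_map]
  · rw [finsetSum_coeff, Finset.sum_eq_single (Fin.last m)]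
    · rw [leadingCoeff_map, leadingCoeff_map, Fin.val_last, coeff_C_mul_X_pow, if_pos rfl]
      intro h0
      have h1 : algebraMap (MvPolynomial (Fin (m + 1)) F) (ParamField F m)
          (MvPolynomial.C (L.a + L.b * f₀).leadingCoeff +
            MvPolynomial.C L.b.leadingCoeff * MvPolynomial.X (Fin.last m)) = 0 := by
        rw [map_add, map_mul]
        exact h0
      rw [map_eq_zero_iff _ (IsFractionRing.injective _ _)] at h1
      have e0 := congrArg (MvPolynomial.eval fun _ => (0 : F)) h1
      have e1 := congrArg (MvPolynomial.eval fun _ => (1 : F)) h1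
      simp only [map_add, map_mul, MvPolynomial.eval_C, MvPolynomial.eval_X, mul_zero, add_zero,
        map_zero, mul_one] at e0 e1
      rw [e0, zero_add] at e1
      exact leadingCoeff_ne_zero.mpr L.b_ne_zero e1
    · intro j _ hj
      rw [coeff_C_mul_X_pow, if_neg]
      intro h
      exact hj (Fin.ext h.symm)
    · simp

/-- The arc `A_l = α_l + s (c_l - α_l)` through the point `α` of the parameter space, where
`c` is the generic point. -/
noncomputable def arcCoord (α : Fin (m + 1) → F) (l : Fin (m + 1)) :
    (AlgebraicClosure (ParamField F m))[X] :=
  C (algebraMap F _ (α l)) +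
    X * C (algebraMap (ParamField F m) _ (paramVar F m l) - algebraMap F _ (α l))

/-- The ring homomorphism `F[A] → E[[s]]` given by the arc. -/
noncomputable def arcHom (α : Fin (m + 1) → F) :
    MvPolynomial (Fin (m + 1)) F →+* PowerSeries (AlgebraicClosure (ParamField F m)) :=
  coeToPowerSeries.ringHom.comp
    (MvPolynomial.eval₂Hom (C.comp (algebraMap F (AlgebraicClosure (ParamField F m))))
      (arcCoord α))

theorem arcHom_C (α : Fin (m + 1) → F) (c : F) :
    arcHom α (MvPolynomial.C c) = PowerSeries.C (algebraMap F _ c) := by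
  simp [arcHom]

theorem arcHom_X (α : Fin (m + 1) → F) (l : Fin (m + 1)) :
    arcHom α (MvPolynomial.X l) = PowerSeries.C (algebraMap F _ (α l)) +
      PowerSeries.X * PowerSeries.C (algebraMap (ParamField F m) _ (paramVar F m l) -
        algebraMap F _ (α l)) := by
  simp [arcHom, arcCoord]

/-- At s = 1 the arc reaches the generic point, where evaluation is the inclusion of F[A]. -/
theorem arcHom_injective (α : Fin (m + 1) → F) : Function.Injective (arcHom α) := by
  refine Function.Injective.comp (g := coeToPowerSeries.ringHom) (coe_injective _) ?_
  refine Function.Injective.of_comp (f := evalRingHom 1) ?_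
  have : (evalRingHom 1).comp (MvPolynomial.eval₂Hom
      (C.comp (algebraMap F (AlgebraicClosure (ParamField F m)))) (arcCoord α)) =
      (algebraMap (ParamField F m) (AlgebraicClosure (ParamField F m))).comp
        (algebraMap (MvPolynomial (Fin (m + 1)) F) (ParamField F m)) := by
    refine MvPolynomial.ringHom_ext (fun c => ?_) fun l => ?_
    · simp only [RingHom.comp_apply, MvPolynomial.eval₂Hom_C, coe_evalRingHom, eval_C]
      exact IsScalarTower.algebraMap_apply F (ParamField F m) _ c
    · simp only [RingHom.comp_apply, MvPolynomial.eval₂Hom_X', coe_evalRingHom, arcCoord, eval_add,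
        eval_mul, eval_C, eval_X, one_mul, add_sub_cancel]
      rfl
  have h1 := congrArg (fun φ : _ →+* _ => (φ : _ → AlgebraicClosure (ParamField F m))) this
  refine (congrArg Function.Injective h1).mpr ?_
  exact (algebraMap (ParamField F m) (AlgebraicClosure (ParamField F m))).injective.comp
    (IsFractionRing.injective _ _)

/-- `L(f)` along the arc, as a polynomial over the power series. -/
noncomputable def arcEval (L : LinearFunction F) (f₀ : F[X]) (α : Fin (m + 1) → F) :
    (PowerSeries (AlgebraicClosure (ParamField F m)))[X] :=
  L.a.map ((arcHom α).comp MvPolynomial.C) + L.b.map ((arcHom α).comp MvPolynomial.C) *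
    (f₀.map ((arcHom α).comp MvPolynomial.C) +
      ∑ l : Fin (m + 1), C (arcHom α (MvPolynomial.X l)) * X ^ (l : ℕ))

/-- The extension of the arc to the field `F(A)`. -/
noncomputable def arcFieldHom (α : Fin (m + 1) → F) {K : Type*} [Field K]
    {ι : PowerSeries (AlgebraicClosure (ParamField F m)) →+* K} (hι : Function.Injective ι) :
    ParamField F m →+* K :=
  IsFractionRing.lift (g := ι.comp (arcHom α)) (hι.comp (arcHom_injective α))

theorem arcFieldHom_algebraMap (α : Fin (m + 1) → F) {K : Type*} [Field K]
    {ι : PowerSeries (AlgebraicClosure (ParamField F m)) →+* K} (hι : Function.Injective ι)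
    (a : MvPolynomial (Fin (m + 1)) F) :
    arcFieldHom α hι (algebraMap _ _ a) = ι (arcHom α a) :=
  IsFractionRing.lift_algebraMap _ a

theorem map_arcFieldHom_eval (L : LinearFunction F) (f₀ : F[X]) (α : Fin (m + 1) → F)
    {K : Type*} [Field K] {ι : PowerSeries (AlgebraicClosure (ParamField F m)) →+* K}
    (hι : Function.Injective ι) :
    (L.eval (genericPerturbation m f₀)).map (arcFieldHom α hι) = (arcEval L f₀ α).map ι := by
  have hF : (arcFieldHom α hι).comp (algebraMap F (ParamField F m)) =
      ι.comp ((arcHom α).comp MvPolynomial.C) := by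
    ext c
    exact arcFieldHom_algebraMap α hι (MvPolynomial.C c)
  have hA : ∀ l, arcFieldHom α hι (paramVar F m l) = ι (arcHom α (MvPolynomial.X l)) := fun l =>
    arcFieldHom_algebraMap α hι (MvPolynomial.X l)
  simp only [LinearFunction.eval, genericPerturbation, arcEval, Polynomial.map_add,
    Polynomial.map_mul, Polynomial.map_sum, Polynomial.map_pow, map_C, map_X, map_map, hF, hA]

theorem map_constantCoeff_arcEval (L : LinearFunction F) (f₀ : F[X]) (α : Fin (m + 1) → F) :
    (arcEval L f₀ α).map
      (PowerSeries.constantCoeff (R := AlgebraicClosure (ParamField F m))) =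
      (L.eval (f₀ + ∑ l, C (α l) * X ^ (l : ℕ))).map (algebraMap F _) := by
  have hF : (PowerSeries.constantCoeff (R := AlgebraicClosure (ParamField F m))).comp
      ((arcHom α).comp MvPolynomial.C) = algebraMap F _ := by
    ext c
    simp [arcHom_C]
  have hA : ∀ l, PowerSeries.constantCoeff (arcHom α (MvPolynomial.X l)) =
      algebraMap F (AlgebraicClosure (ParamField F m)) (α l) := fun l => by
    simp [arcHom_X]
  simp only [LinearFunction.eval_self, arcEval, Polynomial.map_add,
    Polynomial.map_mul, Polynomial.map_sum, Polynomial.map_pow, map_C, map_X, map_map, hF, hA]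

theorem coeff_one_eval_arcEval_ne_zero (L : LinearFunction F) (f₀ : F[X]) (α : Fin (m + 1) → F)
    {x : F} (hx : L.b.eval x ≠ 0) :
    PowerSeries.coeff 1 ((arcEval L f₀ α).eval (PowerSeries.C (algebraMap F _ x))) ≠ 0 := by
  let E := AlgebraicClosure (ParamField F m)
  have hev : ∀ q : F[X], (q.map ((arcHom α).comp MvPolynomial.C)).eval
      (PowerSeries.C (algebraMap F E x)) = PowerSeries.C (algebraMap F E (q.eval x)) := fun q => by
    have h1 : (arcHom α).comp MvPolynomial.C = (PowerSeries.C (R := E)).comp (algebraMap F E) :=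
      RingHom.ext fun c => arcHom_C α c
    rw [h1]
    exact eval_map_apply ((PowerSeries.C (R := E)).comp (algebraMap F E)) x
  have hB : (∑ l : Fin (m + 1), (algebraMap (ParamField F m) E (paramVar F m l) -
      algebraMap F E (α l)) * algebraMap F E x ^ (l : ℕ)) ≠ 0 := by
    have h1 : (∑ l : Fin (m + 1), (algebraMap (ParamField F m) E (paramVar F m l) -
        algebraMap F E (α l)) * algebraMap F E x ^ (l : ℕ)) =
        algebraMap (ParamField F m) E (algebraMap (MvPolynomial (Fin (m + 1)) F) (ParamField F m)
        (∑ l : Fin (m + 1), (MvPolynomial.X l - MvPolynomial.C (α l)) *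
          MvPolynomial.C x ^ (l : ℕ))) := by
      have hC : ∀ c : F, algebraMap (ParamField F m) E (algebraMap (MvPolynomial (Fin (m + 1)) F)
          (ParamField F m) (MvPolynomial.C c)) = algebraMap F E c := fun c =>
        (IsScalarTower.algebraMap_apply F (ParamField F m) E c).symm
      simp only [map_sum, map_mul, map_sub, map_pow, hC]
      rfl
    rw [h1, Ne, map_eq_zero, map_eq_zero_iff _ (IsFractionRing.injective _ _)]
    intro h0
    -- At this point only the term `l = 0` survives, with value 1.
    have h2 := congrArg (MvPolynomial.eval (α + Pi.single 0 1)) h0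
    simp only [map_sum, map_mul, map_sub, MvPolynomial.eval_X, MvPolynomial.eval_C, map_pow,
      Pi.add_apply, add_sub_cancel_left, map_zero] at h2
    rw [Finset.sum_eq_single 0] at h2
    · simp at h2
    · intro l _ hl
      simp [hl]
    · simp
  have hsum : ((arcEval L f₀ α).eval (PowerSeries.C (algebraMap F E x))) =
      PowerSeries.C (algebraMap F E (L.a.eval x + L.b.eval x *
        (f₀.eval x + ∑ l : Fin (m + 1), α l * x ^ (l : ℕ)))) +
      PowerSeries.X * PowerSeries.C (algebraMap F E (L.b.eval x) *
        ∑ l : Fin (m + 1), (algebraMap (ParamField F m) E (paramVar F m l) -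
          algebraMap F E (α l)) * algebraMap F E x ^ (l : ℕ)) := by
    simp only [arcEval, eval_add, eval_mul, hev, eval_finsetSum, eval_C, eval_pow, eval_X,
      arcHom_X, map_add, map_mul, map_sum, map_pow, add_mul, Finset.sum_add_distrib]
    have : ∑ l : Fin (m + 1), PowerSeries.X * PowerSeries.C (algebraMap (ParamField F m) E
        (paramVar F m l) - algebraMap F E (α l)) * PowerSeries.C (algebraMap F E x) ^ (l : ℕ) =
        PowerSeries.X * ∑ l : Fin (m + 1), PowerSeries.C (algebraMap (ParamField F m) E
        (paramVar F m l) - algebraMap F E (α l)) * PowerSeries.C (algebraMap F E x) ^ (l : ℕ) := by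
      rw [Finset.mul_sum]
      exact Finset.sum_congr rfl fun l _ => mul_assoc _ _ _
    rw [this]
    ring
  rw [hsum, map_add, PowerSeries.coeff_C, if_neg one_ne_zero, zero_add]
  refine ne_of_eq_of_ne (PowerSeries.coeff_succ_X_mul 0 _) ?_
  rw [PowerSeries.coeff_zero_C]
  exact mul_ne_zero ((_root_.map_ne_zero _).mpr hx) hB

/-- For every `i` there is an automorphism of the splitting field of `∏ L_j(f)` which exchanges two
roots of `L_i(f)` and fixes all other roots. -/
theorem exists_isSwap_gal [IsAlgClosed F] (h2 : (2 : F) ≠ 0) {n : ℕ} (hm : 2 ≤ m)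
    (L : Fin n → LinearFunction F) (hprim : ∀ i, (L i).IsPrimitive)
    (hdist : ∀ i j, i ≠ j → ¬ (L i).IsAssociated (L j)) (f₀ : F[X])
    (hcancel : ∀ i, (L i).b.natDegree + m ≤ ((L i).eval f₀).natDegree) (i : Fin n)
    (hsep : ((L i).eval (genericPerturbation m f₀)).Separable)
    [DecidableEq (((L i).eval (genericPerturbation m f₀)).rootSet
      ((L i).eval (genericPerturbation m f₀)).SplittingField)] :
    ∃ g τ, galProdRestrict (fun j => (L j).eval (genericPerturbation m f₀)) g = Pi.mulSingle i τ ∧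
      (galRootPerm ((L i).eval (genericPerturbation m f₀)) τ).IsSwap := by
  obtain ⟨α, x, q, hdeg, hsepj, hfac, hq, hqx, hbx⟩ :=
    exists_specialization h2 hm L hprim hdist f₀ hcancel i
  let E := AlgebraicClosure (ParamField F m)
  have hnat : ∀ j, (arcEval (L j) f₀ α).natDegree = ((L j).eval f₀).natDegree := fun j => by
    have hinj := IsFractionRing.injective (PowerSeries E) (FractionRing (PowerSeries E))
    rw [← natDegree_map_eq_of_injective hinj, ← map_arcFieldHom_eval (L j) f₀ α hinj, natDegree_map,
      natDegree_eval_genericPerturbation _ (hcancel j)]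
  obtain ⟨K', _, ι, σ, hι, hσι, hsplit, hfix, ⟨y, hy, hσy⟩, S, hS, hcard⟩ :=
    exists_ringEquiv_of_double_root_constantCoeff (E := E) (fun j => arcEval (L j) f₀ α)
      (fun j => by rw [map_constantCoeff_arcEval, natDegree_map, hdeg, hnat]) i
      (fun j hj => by rw [map_constantCoeff_arcEval]; exact (hsepj j hj).map)
      (x := algebraMap F E x) (q := q.map (algebraMap F E))
      (by rw [map_constantCoeff_arcEval, hfac]; simp [E]) hq.map
      (by rw [eval_map_apply]; exact (_root_.map_ne_zero _).mpr hqx)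
      (coeff_one_eval_arcEval_ne_zero (L i) f₀ α hbx)
      (by rw [← map_arcFieldHom_eval _ _ _ (IsFractionRing.injective _ _)]; exact hsep.map)
  let Φ := arcFieldHom α hι
  let _ : Algebra (ParamField F m) K' := Φ.toAlgebra
  have hroot : ∀ j (z : K'), aeval z ((L j).eval (genericPerturbation m f₀)) =
      ((arcEval (L j) f₀ α).map ι).eval z := fun j z => by
    rw [← eval_map_algebraMap, ← map_arcFieldHom_eval (L j) f₀ α hι]
    rfl
  -- `σ` fixes all power series, and the arc sends the generators of F(A) to power series, so `σ` is
  -- F(A)-linear.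
  have hσΦ : (σ : K' →+* K').comp Φ = Φ := by
    refine ParamField.ringHom_ext (fun c => ?_) fun l => ?_
    · have := arcFieldHom_algebraMap α hι (MvPolynomial.C c)
      have h3 : Φ (algebraMap F _ c) = ι (arcHom α (MvPolynomial.C c)) := this
      rw [RingHom.comp_apply, h3]
      exact hσι _
    · have h3 : Φ (paramVar F m l) = ι (arcHom α (MvPolynomial.X l)) :=
        arcFieldHom_algebraMap α hι (MvPolynomial.X l)
      rw [RingHom.comp_apply, h3]
      exact hσι _
  let σ' : Gal(K'/ParamField F m) :=
    AlgEquiv.ofRingEquiv (f := σ) fun a => RingHom.congr_fun hσΦ a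
  refine exists_galProdRestrict_eq_mulSingle_isSwap
    (fun j => (L j).eval (genericPerturbation m f₀)) (fun j h0 => ?_) (E := K') (fun j => ?_) σ' i
    (fun j hj z hz => hfix j hj z ?_) ⟨y, ?_, hσy⟩ S (fun z hz => ⟨?_, (hS z hz).2⟩) ?_
  · have := natDegree_eval_genericPerturbation (L j) (hcancel j)
    have h3 := hcancel j
    rw [← this, h0, natDegree_zero] at h3
    omega
  · have := hsplit j
    rw [← map_arcFieldHom_eval (L j) f₀ α hι] at this
    exact this
  · rw [← hroot]; exact hz
  · exact (hroot i y).trans hy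
  · exact (hroot i z).trans (hS z hz).1
  · rw [natDegree_eval_genericPerturbation (L i) (hcancel i), ← hnat i]
    exact hcard

end Degeneration

/-! ### Assembly of the Galois group. -/

theorem proposition2p5 {F : Type*} [Field F] [IsAlgClosed F] (hchar : ringChar F ≠ 2)
    {n m k : ℕ} (hm : 2 ≤ m) (hmk : m < k)
    (L : Fin n → LinearFunction F) (hprim : ∀ i, (L i).IsPrimitive)
    (hdist : ∀ i j, i ≠ j → ¬ (L i).IsAssociated (L j))
    (f₀ : F[X]) (hmonic : f₀.Monic) (hdeg : f₀.natDegree = k)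
    (hcancel : ∀ i, (L i).b.natDegree + m ≤ ((L i).eval f₀).natDegree) :
    -- the restriction map identifies `Gal(∏ L_i(f))` with `∏ Gal(L_i(f))`
    Function.Bijective (galProdRestrict fun i => (L i).eval (genericPerturbation m f₀)) ∧
    -- `L_i(f)` has `k_i = deg L_i(f₀)` distinct roots, and `Gal(L_i(f))` is the full symmetric
    -- group on them
    (∀ i,
      Nat.card (((L i).eval (genericPerturbation m f₀)).rootSet
        ((L i).eval (genericPerturbation m f₀)).SplittingField) = ((L i).eval f₀).natDegree ∧
      Function.Bijective (galRootPerm ((L i).eval (genericPerturbation m f₀)))) ∧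
    -- so `Gal(∏ L_i(f)) ≅ S_{k_1} × ⋯ × S_{k_n}`
    Nonempty ((∏ i, (L i).eval (genericPerturbation m f₀)).Gal ≃*
      ∀ i, Equiv.Perm (Fin ((L i).eval f₀).natDegree)) := by
  classical
  let p : Fin n → (ParamField F m)[X] := fun i => (L i).eval (genericPerturbation m f₀)
  have hsep : ∀ i, (p i).Separable := fun i => by
    obtain ⟨l, rfl⟩ : ∃ l, m = l + 1 := ⟨m - 1, by omega⟩
    exact (hprim i).separable_eval_genericPerturbation l f₀
  have hp : ∀ i, p i ≠ 0 := fun i => (hsep i).ne_zero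
  have hP : ∏ i, p i ≠ 0 := Finset.prod_ne_zero_iff.mpr fun i _ => hp i
  have htrans : ∀ i, ∀ x y x' y' : (p i).rootSet (p i).SplittingField, x ≠ y → x' ≠ y' →
      ∃ g, galRootPerm (p i) g x = x' ∧ galRootPerm (p i) g y = y' := by
    intro i x y x' y' hxy hxy'
    obtain ⟨l, rfl⟩ : ∃ l, m = l + 1 := ⟨m - 1, by omega⟩
    have hr : ∀ z : (p i).rootSet (p i).SplittingField,
        aeval (z : (p i).SplittingField) (p i) = 0 := fun z => (mem_rootSet.mp z.2).2
    obtain ⟨σ, h1, h2⟩ := exists_algEquiv_map_pair (Ω := (p i).SplittingField) (hprim i) f₀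
      (Subtype.coe_ne_coe.mpr hxy) (Subtype.coe_ne_coe.mpr hxy') (hr x) (hr y) (hr x') (hr y')
    exact ⟨σ, Subtype.ext h1, Subtype.ext h2⟩
  obtain ⟨hsurj, hsurj'⟩ := MonoidHom.surjective_pi_of_isSwap (fun i => galRootPerm (p i))
    (fun i => galRootPerm_injective (p i)) htrans (galProdRestrict p)
    (fun i h => Gal.restrictDvd_surjective (Finset.dvd_prod_of_mem p (Finset.mem_univ i)) hP h)
    fun i => exists_isSwap_gal (Ring.two_ne_zero hchar) hm L hprim hdist f₀ hcancel i (hsep i)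
  have hbij : Function.Bijective (galProdRestrict p) := ⟨galProdRestrict_injective p hp, hsurj⟩
  have hbij' : ∀ i, Function.Bijective (galRootPerm (p i)) := fun i =>
    ⟨galRootPerm_injective (p i), hsurj' i⟩
  have hcard : ∀ i, Nat.card ((p i).rootSet (p i).SplittingField) =
      ((L i).eval f₀).natDegree := fun i => by
    rw [← natDegree_eval_genericPerturbation (L i) (hcancel i), Nat.card_eq_fintype_card]
    exact card_rootSet_eq_natDegree (hsep i) (SplittingField.splits (p i))
  refine ⟨hbij, fun i => ⟨hcard i, hbij' i⟩, ⟨?_⟩⟩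
  exact (MulEquiv.ofBijective _ hbij).trans (MulEquiv.piCongrRight fun i =>
    (MulEquiv.ofBijective _ (hbij' i)).trans (Finite.equivFinOfCardEq (hcard i)).permCongrHom)
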